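/- Let $R$ be a commutative ring, let $A,B$ be (associative, unital, not necessarily commutative) $R$-algebras and let $\beta:A\to B$ be an $R$-algebra morphism. Let $\mathcal C$ be a coassociative counital $A$-coring and $\mathcal D$ a coassociative counital $B$-coring, and let $(\theta:\beta):(\mathcal C:A)\to(\mathcal D:B)$ be a morphism of corings, i.e. $\theta:\mathcal C\to\mathcal D$ is $(A,A)$-bilinear (with $A$ acting on $\mathcal D$ through $\beta$), $\Delta_{\mathcal D}(\theta(c))=\sum\theta(c_1)\otimes_B\theta(c_2)$ and $\varepsilon_{\mathcal D}(\theta(c))=\beta(\varepsilon_{\mathcal C}(c))$ for all $c\in\mathcal C$. A left $A$-module $W$ is called locally projective if for every finitely generated submodule $F\subseteq W$, every surjective $A$-linear map $\pi:L\to N$ and every $A$-linear map $g:W\to N$ there is an $A$-linear map $g':W\to L$ with $\pi\circ g'|_F=g|_F$. Assume that ${}_A\mathcal C$ and ${}_B\mathcal D$ are locally projective. Let ${}^*\mathcal C=\mathrm{Hom}_{A-}(\mathcal C,A)$ be the left dual ring, with product $(f\star g)(c)=\sum g(c_1f(c_2))$, unit $\varepsilon_{\mathcal C}$ and $A\to{}^*\mathcal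 C$, $a\mapsto\varepsilon_{\mathcal C}(-)a$; similarly ${}^*\mathcal D=\mathrm{Hom}_{B-}(\mathcal D,B)$. The group $\mathrm{Hom}_{A-}(\mathcal C,B)$ is a $({}^*\mathcal C,{}^*\mathcal D)$-bimodule via $(\phi\rightharpoonup h)(c)=\sum h(c_1\phi(c_2))$ and $(h\leftharpoonup g)(c)=\sum g(\theta(c_1)h(c_2))$. Put ${}_\#\mathcal C=\{\beta\circ f: f\in{}^*\mathcal C\}$ and ${}_\#\mathcal D=\{g\circ\theta: g\in{}^*\mathcal D\}$ in $\mathrm{Hom}_{A-}(\mathcal C,B)$, and assume that $(\theta:\beta)$ is compatible, i.e. ${}_\#\mathcal D\subseteq{}_\#\mathcal C$; then ${}_\#\mathcal C$ is a $({}^*\mathcal C,{}^*\mathcal D)$-subbimodule. Let $\mathbb M^{\mathcal C}$, $\mathbb M^{\mathcal D}$ be the categories of counital right comodules and colinear maps. A right $\mathcal D$-comodule $N$ is a right ${}^*\mathcal D$-module by $n\cdot g=\sum n_{<0>}g(n_{<1>})$. For a right ${}^*\mathcal C$-module $M$, $\mathrm{Rat}^{\mathcal C}(M)$ is the submodule of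 all $m\in M$ for which there is $\sum m_i\otimes_A c_i\in M\otimes_A\mathcal C$ with $m\cdot f=\sum m_if(c_i)$ for all $f\in{}^*\mathcal C$; it is a right $\mathcal C$-comodule with coaction $m\mapsto\sum m_i\otimes_A c_i$. The coinduction functor is $$\mathrm{Coind}_{\mathcal D}^{\mathcal C}:\mathbb M^{\mathcal D}\to\mathbb M^{\mathcal C},\qquad N\mapsto\mathrm{Rat}^{\mathcal C}(\mathrm{Hom}_{-{}^*\mathcal D}({}_\#\mathcal C,N)),$$ where ${}^*\mathcal C$ acts on $\mathrm{Hom}_{-{}^*\mathcal D}({}_\#\mathcal C,N)$ by $(\varphi\leftharpoonup\psi)(h)=\varphi(\psi\rightharpoonup h)$. The ad-induction functor is $$-\,\square_{\mathcal D}(B\otimes_A\mathcal C):\mathbb M^{\mathcal D}\to\mathbb M^{\mathcal C},$$ where $B\otimes_A\mathcal C$ carries the left $\mathcal D$-coaction $b\otimes_A c\mapsto\sum b\theta(c_1)\otimes_B(1\otimes_A c_2)$, $N\,\square_{\mathcal D}(B\otimes_A\mathcal C)\subseteq N\otimes_B(B\otimes_A\mathcal C)$ is the cotensor product (the kernel of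 the difference of the two induced maps to $N\otimes_B\mathcal D\otimes_B(B\otimes_A\mathcal C)$), and its right $\mathcal C$-coaction is induced by $\Delta_{\mathcal C}$. Then there is an isomorphism of functors $\mathbb M^{\mathcal D}\to\mathbb M^{\mathcal C}$ $$\mathrm{Coind}_{\mathcal D}^{\mathcal C}(-)\;\simeq\;-\,\square_{\mathcal D}(B\otimes_A\mathcal C).$$ -/

import Mathlib

open MulOpposite
open CategoryTheory (Category)
open scoped CategoryTheory

universe u v

set_option linter.unusedSectionVars false

namespace Corings

/-! ### Tensor products over a noncommutative ring

Right `A`-modules are modules over `Aᵐᵒᵖ`; an `(A, B)`-bimodule is a left `A`-module and right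
`B`-module with commuting actions. -/

section Tensor

/-- The subgroup of `M ⊗ N` generated by the elements `m a ⊗ n - m ⊗ a n`. -/
def balanceRel (A M N : Type*) [Ring A] [AddCommGroup M] [AddCommGroup N] [Module Aᵐᵒᵖ M]
    [Module A N] : AddSubgroup (TensorProduct ℤ M N) :=
  AddSubgroup.closure {x | ∃ (m : M) (a : A) (n : N),
    x = TensorProduct.tmul ℤ (op a • m) n - TensorProduct.tmul ℤ m (a • n)}

/-- The tensor product `M ⊗_A N` of a right `A`-module and a left `A`-module. -/
def TensorOver (A M N : Type*) [Ring A] [AddCommGroup M] [AddCommGroup N] [Module Aᵐᵒᵖ M]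
    [Module A N] : Type _ :=
  TensorProduct ℤ M N ⧸ balanceRel A M N

namespace TensorOver

variable {A B M N P M' N' : Type*} [Ring A] [Ring B] [AddCommGroup M] [AddCommGroup N]
  [AddCommGroup P] [AddCommGroup M'] [AddCommGroup N'] [Module Aᵐᵒᵖ M] [Module A N]

instance : AddCommGroup (TensorOver A M N) :=
  inferInstanceAs (AddCommGroup (TensorProduct ℤ M N ⧸ balanceRel A M N))

/-- The quotient map `M ⊗ N → M ⊗_A N`. -/
def mk : TensorProduct ℤ M N →+ TensorOver A M N := QuotientAddGroup.mk' (balanceRel A M N)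

variable (A) in
/-- The biadditive map `(m, n) ↦ m ⊗ n`. -/
def tmulHom : M →+ N →+ TensorOver A M N :=
  AddMonoidHom.mk' (fun m => AddMonoidHom.mk'
      (fun n => mk (TensorProduct.tmul ℤ m n))
      (fun n n' => by rw [TensorProduct.tmul_add, map_add]))
    (fun m m' => by
      ext n
      change mk (TensorProduct.tmul ℤ (m + m') n) = _
      rw [TensorProduct.add_tmul, map_add]; rfl)

variable (A) in
/-- The pure tensor `m ⊗ n` in `M ⊗_A N`. -/
def tmul (m : M) (n : N) : TensorOver A M N := tmulHom A m n

@[simp] theorem tmulHom_apply (m : M) (n : N) : tmulHom A m n = tmul A m n := rfl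

@[simp] theorem zero_tmul (n : N) : tmul A (0 : M) n = 0 := by simp [← tmulHom_apply]

@[simp] theorem tmul_zero (m : M) : tmul A m (0 : N) = 0 := by simp [← tmulHom_apply]

theorem add_tmul (m m' : M) (n : N) : tmul A (m + m') n = tmul A m n + tmul A m' n := by
  simp [← tmulHom_apply]

theorem tmul_add (m : M) (n n' : N) : tmul A m (n + n') = tmul A m n + tmul A m n' := by
  simp [← tmulHom_apply]

theorem smul_tmul (m : M) (a : A) (n : N) : tmul A (op a • m) n = tmul A m (a • n) := by
  rw [← sub_eq_zero]
  change mk _ - mk _ = 0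
  rw [← map_sub]
  exact (QuotientAddGroup.eq_zero_iff _).2 (AddSubgroup.subset_closure ⟨m, a, n, rfl⟩)

theorem induction_on {motive : TensorOver A M N → Prop} (z : TensorOver A M N)
    (zero : motive 0) (tmul : ∀ m n, motive (tmul A m n))
    (add : ∀ x y, motive x → motive y → motive (x + y)) : motive z := by
  obtain ⟨z, rfl⟩ : ∃ y, mk y = z := QuotientAddGroup.mk'_surjective (balanceRel A M N) z
  induction z using TensorProduct.induction_on with
  | zero => rw [map_zero]; exact zero
  | tmul m n => exact tmul m n
  | add x y hx hy => rw [map_add]; exact add _ _ hx hy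

theorem hom_ext {f g : TensorOver A M N →+ P} (h : ∀ m n, f (tmul A m n) = g (tmul A m n)) :
    f = g := by
  ext z
  induction z using induction_on with
  | zero => simp
  | tmul m n => exact h m n
  | add x y hx hy => simp [hx, hy]

/-- The universal property: balanced biadditive maps factor through `M ⊗_A N`. -/
def lift (f : M →+ N →+ P) (hf : ∀ m (a : A) n, f (op a • m) n = f m (a • n)) :
    TensorOver A M N →+ P :=
  QuotientAddGroup.lift (balanceRel A M N)
    (TensorProduct.liftAddHom f (by intro r m n; simp))
    (by
      refine (AddSubgroup.closure_le _).2 ?_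
      rintro _ ⟨m, a, n, rfl⟩
      simp [hf])

@[simp] theorem lift_tmul (f : M →+ N →+ P) (hf : ∀ m (a : A) n, f (op a • m) n = f m (a • n))
    (m : M) (n : N) : lift f hf (tmul A m n) = f m n := by
  change TensorProduct.liftAddHom f (by intro r m n; simp) (TensorProduct.tmul ℤ m n) = _
  simp

/-- The map `M ⊗_A N → M' ⊗_B N'`, `m ⊗ n ↦ f m ⊗ g n`, for `f`, `g` semilinear along a ring
morphism `β : A → B`. -/
def mapSemi [Module Bᵐᵒᵖ M'] [Module B N'] (β : A →+* B) (f : M →+ M') (g : N →+ N')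
    (hf : ∀ (a : A) m, f (op a • m) = op (β a) • f m)
    (hg : ∀ (a : A) n, g (a • n) = β a • g n) : TensorOver A M N →+ TensorOver B M' N' :=
  lift (AddMonoidHom.mk' (fun m => (tmulHom B (f m)).comp g) (fun m m' => by ext; simp))
    (by
      intro m a n
      change tmul B (f (op a • m)) (g n) = tmul B (f m) (g (a • n))
      rw [hf, hg, smul_tmul])

@[simp] theorem mapSemi_tmul [Module Bᵐᵒᵖ M'] [Module B N'] (β : A →+* B) (f : M →+ M')
    (g : N →+ N') (hf : ∀ (a : A) m, f (op a • m) = op (β a) • f m)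
    (hg : ∀ (a : A) n, g (a • n) = β a • g n) (m : M) (n : N) :
    mapSemi β f g hf hg (tmul A m n) = tmul B (f m) (g n) :=
  lift_tmul _ _ _ _

/-- The map `f ⊗_A g : M ⊗_A N → M' ⊗_A N'`. -/
def map [Module Aᵐᵒᵖ M'] [Module A N'] (f : M →+ M') (g : N →+ N')
    (hf : ∀ (a : A) m, f (op a • m) = op a • f m)
    (hg : ∀ (a : A) n, g (a • n) = a • g n) : TensorOver A M N →+ TensorOver A M' N' :=
  mapSemi (RingHom.id A) f g hf hg

@[simp] theorem map_tmul [Module Aᵐᵒᵖ M'] [Module A N'] (f : M →+ M') (g : N →+ N')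
    (hf : ∀ (a : A) m, f (op a • m) = op a • f m)
    (hg : ∀ (a : A) n, g (a • n) = a • g n) (m : M) (n : N) :
    map f g hf hg (tmul A m n) = tmul A (f m) (g n) :=
  mapSemi_tmul _ _ _ _ _ _ _

attribute [irreducible] TensorOver lift mapSemi map


theorem idHom_smul {S X : Type*} [AddCommGroup X] [SMul S X] (s : S) (x : X) :
    AddMonoidHom.id X (s • x) = s • AddMonoidHom.id X x := rfl

/-- The left action of `s` on `M ⊗_A N`, for an `(S, A)`-bimodule `M`. -/
def leftHom {S : Type*} [Ring S] [Module S M] [SMulCommClass S Aᵐᵒᵖ M] (s : S) :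
    TensorOver A M N →+ TensorOver A M N :=
  map (DistribSMul.toAddMonoidHom M s) (AddMonoidHom.id N)
    (fun a m => smul_comm s (op a) m) idHom_smul

theorem leftHom_tmul {S : Type*} [Ring S] [Module S M] [SMulCommClass S Aᵐᵒᵖ M] (s : S) (m : M) (n : N) :
    leftHom s (tmul A m n) = tmul A (s • m) n :=
  map_tmul _ _ _ _ _ _

/-- `M ⊗_A N` is a left `S`-module if `M` is an `(S, A)`-bimodule. -/
instance (priority := low) leftModule {S : Type*} [Ring S] [Module S M] [SMulCommClass S Aᵐᵒᵖ M] :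
    Module S (TensorOver A M N) where
  smul s := leftHom s
  one_smul x := by
    change leftHom _ x = x
    induction x using induction_on with
    | zero => rw [map_zero]
    | tmul m n => simp [leftHom_tmul]
    | add x y hx hy => rw [map_add, hx, hy]
  mul_smul s t x := by
    change leftHom _ x = leftHom _ (leftHom _ x)
    induction x using induction_on with
    | zero => simp only [map_zero]
    | tmul m n => simp [leftHom_tmul, mul_smul]
    | add x y hx hy => simp only [map_add, hx, hy]
  smul_zero s := map_zero (leftHom s)
  smul_add s := map_add (leftHom s)
  add_smul s t x := by
    change leftHom _ x = leftHom _ x + leftHom _ x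
    induction x using induction_on with
    | zero => simp only [map_zero, add_zero]
    | tmul m n => simp [leftHom_tmul, add_smul, add_tmul]
    | add x y hx hy => simp only [map_add, hx, hy]; abel
  zero_smul x := by
    change leftHom _ x = 0
    induction x using induction_on with
    | zero => rw [map_zero]
    | tmul m n => simp [leftHom_tmul]
    | add x y hx hy => rw [map_add, hx, hy, add_zero]

/-- The right action of `s` on `M ⊗_A N`, for an `(A, T)`-bimodule `N`. -/
def rightHom {T : Type*} [Ring T] [Module Tᵐᵒᵖ N] [SMulCommClass A Tᵐᵒᵖ N] (s : Tᵐᵒᵖ) :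
    TensorOver A M N →+ TensorOver A M N :=
  map (AddMonoidHom.id M) (DistribSMul.toAddMonoidHom N s)
    (fun _ _ => idHom_smul _ _) (fun a n => (smul_comm a s n).symm)

theorem rightHom_tmul {T : Type*} [Ring T] [Module Tᵐᵒᵖ N] [SMulCommClass A Tᵐᵒᵖ N] (s : Tᵐᵒᵖ) (m : M) (n : N) :
    rightHom s (tmul A m n) = tmul A m (s • n) :=
  map_tmul _ _ _ _ _ _

/-- `M ⊗_A N` is a right `T`-module if `N` is an `(A, T)`-bimodule. -/
instance rightModule {T : Type*} [Ring T] [Module Tᵐᵒᵖ N] [SMulCommClass A Tᵐᵒᵖ N] :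
    Module Tᵐᵒᵖ (TensorOver A M N) where
  smul s := rightHom s
  one_smul x := by
    change rightHom _ x = x
    induction x using induction_on with
    | zero => rw [map_zero]
    | tmul m n => simp [rightHom_tmul]
    | add x y hx hy => rw [map_add, hx, hy]
  mul_smul s t x := by
    change rightHom _ x = rightHom _ (rightHom _ x)
    induction x using induction_on with
    | zero => simp only [map_zero]
    | tmul m n => simp [rightHom_tmul, mul_smul]
    | add x y hx hy => simp only [map_add, hx, hy]
  smul_zero s := map_zero (rightHom s)
  smul_add s := map_add (rightHom s)
  add_smul s t x := by
    change rightHom _ x = rightHom _ x + rightHom _ x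
    induction x using induction_on with
    | zero => simp only [map_zero, add_zero]
    | tmul m n => simp [rightHom_tmul, add_smul, tmul_add]
    | add x y hx hy => simp only [map_add, hx, hy]; abel
  zero_smul x := by
    change rightHom _ x = 0
    induction x using induction_on with
    | zero => rw [map_zero]
    | tmul m n => simp [rightHom_tmul]
    | add x y hx hy => rw [map_add, hx, hy, add_zero]

theorem right_smul_tmul {T : Type*} [Ring T] [Module Tᵐᵒᵖ N] [SMulCommClass A Tᵐᵒᵖ N]
    (t : T) (m : M) (n : N) : op t • tmul A m n = tmul A m (op t • n) :=
  map_tmul _ _ _ _ _ _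

theorem left_smul_tmul {S : Type*} [Ring S] [Module S M] [SMulCommClass S Aᵐᵒᵖ M]
    (s : S) (m : M) (n : N) : s • tmul A m n = tmul A (s • m) n :=
  map_tmul _ _ _ _ _ _

instance {S T : Type*} [Ring S] [Module S M] [SMulCommClass S Aᵐᵒᵖ M] [Ring T] [Module Tᵐᵒᵖ N]
    [SMulCommClass A Tᵐᵒᵖ N] : SMulCommClass S Tᵐᵒᵖ (TensorOver A M N) where
  smul_comm s t x := by
    induction x using induction_on with
    | zero => simp
    | tmul m n =>
      obtain ⟨t, rfl⟩ := op_surjective t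
      rw [right_smul_tmul, left_smul_tmul, left_smul_tmul, right_smul_tmul]
    | add x y hx hy => simp only [smul_add, hx, hy]

/-- The map `x ⊗ p ↦ (m ⊗ (n ⊗ p))` for `x = m ⊗ n`, as a biadditive map. -/
def assocAux [Module Bᵐᵒᵖ N] [SMulCommClass A Bᵐᵒᵖ N] [Module B P] :
    TensorOver A M N →+ P →+ TensorOver A M (TensorOver B N P) :=
  lift (AddMonoidHom.mk' (fun m => AddMonoidHom.mk'
        (fun n => (tmulHom A m).comp (tmulHom B n)) (fun n n' => by ext; simp [tmul_add]))
      (fun m m' => by ext; simp))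
    (by
      intro m a n; ext p
      change tmul A (op a • m) (tmul B n p) = tmul A m (tmul B (a • n) p)
      rw [smul_tmul, left_smul_tmul])

theorem assocAux_tmul [Module Bᵐᵒᵖ N] [SMulCommClass A Bᵐᵒᵖ N] [Module B P]
    (m : M) (n : N) (p : P) : assocAux (tmul A m n) p = tmul A m (tmul B n p) := by
  rw [assocAux, lift_tmul]; rfl

/-- The associativity map `(M ⊗_A N) ⊗_B P → M ⊗_A (N ⊗_B P)`. -/
def assoc [Module Bᵐᵒᵖ N] [SMulCommClass A Bᵐᵒᵖ N] [Module B P] :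
    TensorOver B (TensorOver A M N) P →+ TensorOver A M (TensorOver B N P) :=
  lift assocAux
    (by
      intro x b p
      induction x using induction_on with
      | zero => simp only [smul_zero, map_zero, AddMonoidHom.zero_apply]
      | tmul m n => rw [right_smul_tmul, assocAux_tmul, assocAux_tmul, smul_tmul]
      | add x y hx hy => simp only [smul_add, map_add, AddMonoidHom.add_apply, hx, hy])

@[simp] theorem assoc_tmul [Module Bᵐᵒᵖ N] [SMulCommClass A Bᵐᵒᵖ N] [Module B P]
    (m : M) (n : N) (p : P) : assoc (tmul B (tmul A m n) p) = tmul A m (tmul B n p) := by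
  rw [assoc, lift_tmul, assocAux_tmul]

/-- The map `M ⊗_A N → M`, `m ⊗ n ↦ m f(n)`, for a left linear functional `f : N → A`. -/
def contract (f : N →ₗ[A] A) : TensorOver A M N →+ M :=
  lift (AddMonoidHom.mk' (fun m => AddMonoidHom.mk' (fun n => op (f n) • m)
      (fun n n' => by simp [add_smul])) (fun m m' => by ext; simp))
    (by intro m a n; simp [mul_smul])

@[simp] theorem contract_tmul (f : N →ₗ[A] A) (m : M) (n : N) :
    contract f (tmul A m n) = op (f n) • m := by
  rw [contract, lift_tmul]; rfl

/-- The map `M ⊗_A N → N`, `m ⊗ n ↦ f(m) n`, for a right linear functional `f : M → A`. -/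
def contractLeft (f : M →+ A) (hf : ∀ (a : A) m, f (op a • m) = f m * a) :
    TensorOver A M N →+ N :=
  lift (AddMonoidHom.mk' (fun m => AddMonoidHom.mk' (fun n => f m • n)
      (fun n n' => by simp)) (fun m m' => by ext; simp [add_smul]))
    (by intro m a n; simp [hf, mul_smul])

@[simp] theorem contractLeft_tmul (f : M →+ A) (hf : ∀ (a : A) m, f (op a • m) = f m * a)
    (m : M) (n : N) : contractLeft f hf (tmul A m n) = f m • n := by
  rw [contractLeft, lift_tmul]; rfl

attribute [irreducible] assoc contract contractLeft

end TensorOver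

end Tensor

open TensorOver

/-! ### Corings, their left duals, and comodules -/

section Coring

theorem idHom_op_smul {A X : Type*} [AddCommGroup X] [SMul Aᵐᵒᵖ X] (a : A) (x : X) :
    AddMonoidHom.id X (op a • x) = op a • AddMonoidHom.id X x := rfl

theorem toAdd_smul {A X Y : Type*} [Ring A] [AddCommGroup X] [AddCommGroup Y] [Module A X]
    [Module A Y] (g : X →ₗ[A] Y) (a : A) (x : X) :
    g.toAddMonoidHom (a • x) = a • g.toAddMonoidHom x := g.map_smul a x

theorem toAdd_op_smul {A S X Y : Type*} [Ring S] [AddCommGroup X] [AddCommGroup Y] [Module S X]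
    [Module S Y] [SMul Aᵐᵒᵖ X] [SMul Aᵐᵒᵖ Y] (g : X →ₗ[S] Y)
    (h : ∀ (a : A) x, g (op a • x) = op a • g x) (a : A) (x : X) :
    g.toAddMonoidHom (op a • x) = op a • g.toAddMonoidHom x := h a x

theorem toAdd_op_smul_mul {A X : Type*} [Ring A] [AddCommGroup X] [Module A X]
    [SMul Aᵐᵒᵖ X] (g : X →ₗ[A] A) (h : ∀ (a : A) x, g (op a • x) = g x * a) (a : A) (x : X) :
    g.toAddMonoidHom (op a • x) = g.toAddMonoidHom x * a := h a x

/-- A coassociative counital `A`-coring structure on an `A`-bimodule `C`. -/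
class Coring (A C : Type u) [Ring A] [AddCommGroup C] [Module A C] [Module Aᵐᵒᵖ C]
    [SMulCommClass A Aᵐᵒᵖ C] where
  /-- The comultiplication `Δ : C → C ⊗_A C`. -/
  comul : C →ₗ[A] TensorOver A C C
  comul_op_smul : ∀ (a : A) (c : C), comul (op a • c) = op a • comul c
  /-- The counit `ε : C → A`. -/
  counit : C →ₗ[A] A
  counit_op_smul : ∀ (a : A) (c : C), counit (op a • c) = counit c * a
  coassoc : ∀ c : C,
    assoc (map comul.toAddMonoidHom (AddMonoidHom.id C) (toAdd_op_smul comul comul_op_smul)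
      idHom_smul (comul c)) =
    map (AddMonoidHom.id C) comul.toAddMonoidHom idHom_op_smul
      (toAdd_smul comul) (comul c)
  counit_comul : ∀ c : C, contractLeft counit.toAddMonoidHom
    (toAdd_op_smul_mul counit counit_op_smul) (comul c) = c
  comul_counit : ∀ c : C, contract counit (comul c) = c

/-- A left `A`-module `W` is locally projective (Zimmermann-Huisgen) if, for every finitely
generated submodule `F` of `W`, every surjection `π : L → N` and every `g : W → N`, there is
`g' : W → L` such that `π ∘ g'` and `g` agree on `F`. -/
def LocallyProjective (A W : Type u) [Ring A] [AddCommGroup W] [Module A W] : Prop :=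
  ∀ F : Submodule A W, F.FG → ∀ (L N : Type u) [AddCommGroup L] [AddCommGroup N] [Module A L]
    [Module A N] (π : L →ₗ[A] N) (g : W →ₗ[A] N), Function.Surjective π →
    ∃ g' : W →ₗ[A] L, ∀ x ∈ F, g x = π (g' x)

variable {A C : Type u} [Ring A] [AddCommGroup C] [Module A C]

variable (A C) in
/-- The left dual `Hom_{A-}(C, A)` of a coring; its ring structure is the left convolution
product. -/
def LeftDual : Type u := C →ₗ[A] A

namespace LeftDual

instance : AddCommGroup (LeftDual A C) := inferInstanceAs (AddCommGroup (C →ₗ[A] A))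

/-- An element of the left dual as a linear map. -/
def toLin (f : LeftDual A C) : C →ₗ[A] A := f

theorem ext {f g : LeftDual A C} (h : ∀ c, f.toLin c = g.toLin c) : f = g :=
  LinearMap.ext h

@[simp] theorem add_toLin (f g : LeftDual A C) : (f + g).toLin = f.toLin + g.toLin := rfl
@[simp] theorem zero_toLin : (0 : LeftDual A C).toLin = 0 := rfl

end LeftDual

theorem contract_add_left {M : Type*} [AddCommGroup M] [Module Aᵐᵒᵖ M] (f g : C →ₗ[A] A)
    (z : TensorOver A M C) : contract (f + g) z = contract f z + contract g z := by
  induction z using TensorOver.induction_on with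
  | zero => simp only [map_zero, add_zero]
  | tmul m n => simp [add_smul]
  | add x y hx hy => simp only [map_add, hx, hy]; abel

theorem contract_zero_left {M : Type*} [AddCommGroup M] [Module Aᵐᵒᵖ M]
    (z : TensorOver A M C) : contract (0 : C →ₗ[A] A) z = 0 := by
  induction z using TensorOver.induction_on with
  | zero => simp only [map_zero]
  | tmul m n => simp
  | add x y hx hy => simp only [map_add, hx, hy, add_zero]

theorem contract_left_smul {M N S : Type*} [AddCommGroup M] [Module Aᵐᵒᵖ M] [AddCommGroup N]
    [Module A N] [Ring S] [Module S M] [SMulCommClass S Aᵐᵒᵖ M] (f : N →ₗ[A] A) (s : S)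
    (z : TensorOver A M N) : contract f (s • z) = s • contract f z := by
  induction z using TensorOver.induction_on with
  | zero => simp only [map_zero, smul_zero]
  | tmul m n => rw [left_smul_tmul, contract_tmul, contract_tmul, smul_comm s]
  | add x y hx hy => simp only [smul_add, map_add, hx, hy]

theorem contract_map {M M' N N' : Type*} [AddCommGroup M] [Module Aᵐᵒᵖ M] [AddCommGroup M']
    [Module Aᵐᵒᵖ M'] [AddCommGroup N] [Module A N] [AddCommGroup N'] [Module A N']
    (u : M →+ M') (g : N →+ N') (hu : ∀ (a : A) m, u (op a • m) = op a • u m)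
    (hg : ∀ (a : A) n, g (a • n) = a • g n) (f : N' →ₗ[A] A) (f' : N →ₗ[A] A)
    (hf : ∀ n, f' n = f (g n)) (z : TensorOver A M N) :
    contract f (map u g hu hg z) = u (contract f' z) := by
  induction z using TensorOver.induction_on with
  | zero => simp only [map_zero]
  | tmul m n => simp [hu, hf]
  | add x y hx hy => simp only [map_add, hx, hy]

theorem contract_assoc {M N P : Type*} [AddCommGroup M] [Module Aᵐᵒᵖ M] [AddCommGroup N]
    [Module A N] [Module Aᵐᵒᵖ N] [SMulCommClass A Aᵐᵒᵖ N] [AddCommGroup P] [Module A P]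
    (f : P →ₗ[A] A) (z : TensorOver A (TensorOver A M N) P) :
    contract f z = map (AddMonoidHom.id M) (contract f : TensorOver A N P →+ N)
      idHom_op_smul (fun a z => contract_left_smul f a z) (assoc z) := by
  induction z using TensorOver.induction_on with
  | zero => simp only [map_zero]
  | tmul x p =>
    induction x using TensorOver.induction_on with
    | zero => simp only [zero_tmul, map_zero]
    | tmul m n => simp [right_smul_tmul]
    | add x y hx hy => simp only [add_tmul, map_add, hx, hy]
  | add x y hx hy => simp only [map_add, hx, hy]

theorem map_map {M M' M'' N N' N'' : Type*} [AddCommGroup M] [Module Aᵐᵒᵖ M] [AddCommGroup M']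
    [Module Aᵐᵒᵖ M'] [AddCommGroup M''] [Module Aᵐᵒᵖ M''] [AddCommGroup N] [Module A N]
    [AddCommGroup N'] [Module A N'] [AddCommGroup N''] [Module A N'']
    (u : M →+ M') (g : N →+ N') (hu : ∀ (a : A) m, u (op a • m) = op a • u m)
    (hg : ∀ (a : A) n, g (a • n) = a • g n)
    (u' : M' →+ M'') (g' : N' →+ N'') (hu' : ∀ (a : A) m, u' (op a • m) = op a • u' m)
    (hg' : ∀ (a : A) n, g' (a • n) = a • g' n) (u'' : M →+ M'') (g'' : N →+ N'')
    (hu'' : ∀ (a : A) m, u'' (op a • m) = op a • u'' m)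
    (hg'' : ∀ (a : A) n, g'' (a • n) = a • g'' n) (h : ∀ m, u'' m = u' (u m))
    (h' : ∀ n, g'' n = g' (g n)) (z : TensorOver A M N) :
    map u' g' hu' hg' (map u g hu hg z) = map u'' g'' hu'' hg'' z := by
  induction z using TensorOver.induction_on with
  | zero => simp only [map_zero]
  | tmul m n => simp [h, h']
  | add x y hx hy => simp only [map_add, hx, hy]

variable [Module Aᵐᵒᵖ C] [SMulCommClass A Aᵐᵒᵖ C] [Coring A C]

/-- The map `c ↦ ∑ c₁ f(c₂)`. -/
def act (f : LeftDual A C) : C →ₗ[A] C where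
  toFun c := contract f.toLin (Coring.comul (A := A) c)
  map_add' := by simp
  map_smul' a c := by rw [map_smul, contract_left_smul]; rfl

theorem act_apply (f : LeftDual A C) (c : C) :
    act f c = contract f.toLin (Coring.comul (A := A) c) := rfl

/-- The relation `∑ ρ(m₀ f(m₁)) = ∑ m₀ ⊗ m₁ f(m₂)` for a coassociative coaction `ρ`. -/
theorem coact_contract {M : Type u} [AddCommGroup M] [Module Aᵐᵒᵖ M]
    (ρ : M →+ TensorOver A M C) (hρ : ∀ (a : A) m, ρ (op a • m) = op a • ρ m)
    (hco : ∀ m, assoc (map ρ (AddMonoidHom.id C) hρ idHom_smul (ρ m)) =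
      map (AddMonoidHom.id M) (Coring.comul (A := A) (C := C)).toAddMonoidHom
        idHom_op_smul (toAdd_smul Coring.comul) (ρ m))
    (f : LeftDual A C) (m : M) :
    ρ (contract f.toLin (ρ m)) = map (AddMonoidHom.id M) (act f).toAddMonoidHom
      idHom_op_smul (toAdd_smul (act f)) (ρ m) := by
  rw [← contract_map ρ (AddMonoidHom.id C) hρ idHom_smul f.toLin f.toLin
    (fun _ => rfl), contract_assoc, hco]
  exact map_map _ _ _ _ _ _ _ _ _ _ _ _ (fun _ => rfl) (fun _ => rfl) _

theorem comul_act (f : LeftDual A C) (c : C) :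
    Coring.comul (A := A) (act f c) = map (AddMonoidHom.id C) (act f).toAddMonoidHom
      idHom_op_smul (toAdd_smul (act f)) (Coring.comul (A := A) c) :=
  coact_contract (Coring.comul (A := A) (C := C)).toAddMonoidHom
    (toAdd_op_smul _ Coring.comul_op_smul)
    Coring.coassoc f c

theorem counit_contract (f : LeftDual A C) (c : C) :
    Coring.counit (A := A) (act f c) = f.toLin c := by
  have h : ∀ z : TensorOver A C C, Coring.counit (A := A) (contract f.toLin z) =
      f.toLin (contractLeft (Coring.counit (A := A)).toAddMonoidHom
        (toAdd_op_smul_mul Coring.counit Coring.counit_op_smul) z) := by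
    intro z
    induction z using TensorOver.induction_on with
    | zero => simp only [map_zero]
    | tmul m n =>
      rw [contract_tmul, contractLeft_tmul, Coring.counit_op_smul, map_smul]; rfl
    | add x y hx hy => simp only [map_add, hx, hy]
  rw [act_apply, h, Coring.counit_comul]

namespace LeftDual

/-- The left convolution product `(f * g)(c) = ∑ g(c₁ f(c₂))`. -/
instance : Mul (LeftDual A C) := ⟨fun f g => g.toLin ∘ₗ act f⟩

/-- The unit of the left dual is the counit. -/
instance : One (LeftDual A C) := ⟨Coring.counit (A := A)⟩

theorem mul_toLin (f g : LeftDual A C) (c : C) : (f * g).toLin c = g.toLin (act f c) := rfl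

theorem one_toLin (c : C) : (1 : LeftDual A C).toLin c = Coring.counit (A := A) c := rfl

end LeftDual

theorem act_mul (f g : LeftDual A C) (c : C) : act (f * g) c = act g (act f c) := by
  rw [act_apply g, comul_act,
    contract_map _ _ _ _ g.toLin (f * g).toLin (fun _ => rfl)]
  rfl

theorem act_one (c : C) : act (1 : LeftDual A C) c = c := Coring.comul_counit c

theorem act_add (f g : LeftDual A C) (c : C) : act (f + g) c = act f c + act g c :=
  contract_add_left _ _ _

theorem act_zero (c : C) : act (0 : LeftDual A C) c = 0 := contract_zero_left _

namespace LeftDual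

instance : Ring (LeftDual A C) :=
  { (inferInstance : AddCommGroup (LeftDual A C)) with
    mul := (· * ·)
    one := 1
    mul_assoc := fun f g h => ext fun c => by simp only [mul_toLin, act_mul]
    one_mul := fun f => ext fun c => by rw [mul_toLin, act_one]
    mul_one := fun f => ext fun c => by rw [mul_toLin, one_toLin, counit_contract]
    left_distrib := fun f g h => ext fun c => by simp [mul_toLin]
    right_distrib := fun f g h => ext fun c => by simp [mul_toLin, act_add]
    zero_mul := fun f => ext fun c => by simp [mul_toLin, act_zero]
    mul_zero := fun f => ext fun c => by simp [mul_toLin] }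

/-- The functional `c ↦ ε(c) a`. -/
def ofBaseFun (a : A) : LeftDual A C :=
  { toFun := fun c => Coring.counit (A := A) c * a
    map_add' := fun c c' => by rw [map_add, add_mul]
    map_smul' := fun b c => by rw [map_smul, smul_mul_assoc]; rfl }

theorem ofBaseFun_toLin (a : A) (c : C) :
    (ofBaseFun a : LeftDual A C).toLin c = Coring.counit (A := A) c * a := rfl

end LeftDual

theorem contract_ofBase {M N : Type*} [AddCommGroup M] [Module Aᵐᵒᵖ M] [AddCommGroup N]
    [Module A N] [Module Aᵐᵒᵖ N] [SMulCommClass A Aᵐᵒᵖ N] (f f' : N →ₗ[A] A) (a : A)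
    (h : ∀ n, f' n = f (op a • n)) (z : TensorOver A M N) :
    contract f' z = contract f (op a • z) := by
  induction z using TensorOver.induction_on with
  | zero => simp only [map_zero, smul_zero]
  | tmul m n => rw [right_smul_tmul, contract_tmul, contract_tmul, h]
  | add x y hx hy => simp only [map_add, hx, hy, smul_add]

theorem act_ofBaseFun (a : A) (c : C) : act (LeftDual.ofBaseFun a) c = op a • c := by
  rw [act_apply, contract_ofBase (Coring.counit (A := A)) _ a
    (fun n => (Coring.counit_op_smul a n).symm), ← Coring.comul_op_smul, Coring.comul_counit]

namespace LeftDual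

variable (A C) in
/-- The ring homomorphism `A → Hom_{A-}(C, A)`, `a ↦ ε(-) a`, making the left dual an
`A`-ring. -/
def ofBase : A →+* LeftDual A C where
  toFun := ofBaseFun
  map_one' := ext fun c => by rw [ofBaseFun_toLin, mul_one]; rfl
  map_mul' a b := ext fun c => by
    rw [mul_toLin, act_ofBaseFun, ofBaseFun_toLin, ofBaseFun_toLin, Coring.counit_op_smul,
      mul_assoc]
  map_zero' := ext fun c => by rw [ofBaseFun_toLin, mul_zero]; rfl
  map_add' a b := ext fun c => by
    rw [add_toLin, LinearMap.add_apply]; simp only [ofBaseFun_toLin, mul_add]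

end LeftDual

/-- A coring is a right module over its left dual, by `c f = ∑ c₁ f(c₂)`. -/
instance : Module (LeftDual A C)ᵐᵒᵖ C where
  smul f c := act (unop f) c
  one_smul := act_one
  mul_smul f g c := act_mul (unop g) (unop f) c
  smul_zero f := map_zero (act (unop f))
  smul_add f := map_add (act (unop f))
  add_smul f g c := act_add (unop f) (unop g) c
  zero_smul := act_zero

theorem op_smul_eq_act (f : LeftDual A C) (c : C) : op f • c = act f c := rfl

instance : SMulCommClass A (LeftDual A C)ᵐᵒᵖ C where
  smul_comm a f c := ((act (unop f)).map_smul a c).symm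

variable (A C) in
/-- A counital right comodule over the `A`-coring `C`. -/
structure Comod where
  /-- The underlying right `A`-module. -/
  carrier : Type u
  [addCommGroup : AddCommGroup carrier]
  [module : Module Aᵐᵒᵖ carrier]
  /-- The coaction. -/
  coact : carrier →ₗ[Aᵐᵒᵖ] TensorOver A carrier C
  coassoc : ∀ m,
    assoc (map coact.toAddMonoidHom (AddMonoidHom.id C) (toAdd_op_smul coact fun a => coact.map_smul (op a))
      idHom_smul (coact m)) =
    map (AddMonoidHom.id carrier) (Coring.comul (A := A) (C := C)).toAddMonoidHom
      idHom_op_smul (toAdd_smul Coring.comul) (coact m)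
  counit : ∀ m, contract (Coring.counit (A := A)) (coact m) = m

namespace Comod

instance : CoeSort (Comod A C) (Type u) := ⟨Comod.carrier⟩

instance (M : Comod A C) : AddCommGroup M := M.addCommGroup
instance (M : Comod A C) : Module Aᵐᵒᵖ M := M.module

/-- Colinear maps of right comodules. -/
@[ext] structure Hom (M N : Comod A C) where
  /-- The underlying right `A`-linear map. -/
  toLin : M →ₗ[Aᵐᵒᵖ] N
  colinear : ∀ m, N.coact (toLin m) =
    map toLin.toAddMonoidHom (AddMonoidHom.id C) (toAdd_op_smul toLin fun a => toLin.map_smul (op a))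
      idHom_smul (M.coact m)

/-- The category of counital right comodules and colinear maps. -/
instance : Category (Comod A C) where
  Hom := Hom
  id M := ⟨LinearMap.id, fun m => by
    have h : ∀ z : TensorOver A M C, z = map (LinearMap.id : M →ₗ[Aᵐᵒᵖ] M).toAddMonoidHom
        (AddMonoidHom.id C) (toAdd_op_smul _ fun a => (LinearMap.id : M →ₗ[Aᵐᵒᵖ] M).map_smul (op a))
        idHom_smul z := by
      intro z
      induction z using TensorOver.induction_on with
      | zero => simp only [map_zero]
      | tmul m n => rw [map_tmul]; rfl
      | add x y hx hy => rw [map_add, ← hx, ← hy]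
    exact h _⟩
  comp f g := ⟨g.toLin ∘ₗ f.toLin, fun m => by
    rw [LinearMap.comp_apply, g.colinear, f.colinear]
    exact map_map _ _ _ _ _ _ _ _ _ _ _ _ (fun _ => rfl) (fun _ => rfl) _⟩

@[simp] theorem id_toLin (M : Comod A C) : Hom.toLin (𝟙 M) = LinearMap.id := rfl
@[simp] theorem comp_toLin {M N P : Comod A C} (f : M ⟶ N) (g : N ⟶ P) :
    Hom.toLin (f ≫ g) = Hom.toLin g ∘ₗ Hom.toLin f := rfl

theorem hom_ext {M N : Comod A C} {f g : M ⟶ N} (h : ∀ m, Hom.toLin f m = Hom.toLin g m) :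
    f = g := Hom.ext (LinearMap.ext h)

end Comod

end Coring

/-! ### Local projectivity and rational modules -/

section Rational

variable {A C : Type u} [Ring A] [AddCommGroup C] [Module A C]

theorem LocallyProjective.exists_sum (hC : LocallyProjective A C) {M : Type*} [AddCommGroup M]
    [Module Aᵐᵒᵖ M] (z : TensorOver A M C) :
    ∃ (S : Finset C) (f : C → C →ₗ[A] A), z = ∑ w ∈ S, tmul A (contract (f w) z) w := by
  classical
  have key : ∀ z : TensorOver A M C, ∃ F : Finset C, ∀ g : C →ₗ[A] (C →₀ A),
      (∀ x ∈ F, Finsupp.linearCombination A id (g x) = x) → ∃ S₀ : Finset C, ∀ S, S₀ ⊆ S →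
        z = ∑ w ∈ S, tmul A (contract (Finsupp.lapply w ∘ₗ g) z) w := by
    intro z
    induction z using TensorOver.induction_on with
    | zero => exact ⟨∅, fun g _ => ⟨∅, fun S _ => by simp⟩⟩
    | tmul m c =>
      refine ⟨{c}, fun g hg => ⟨(g c).support, fun S hS => ?_⟩⟩
      have h := hg c (by simp)
      rw [Finsupp.linearCombination_apply, Finsupp.sum_of_support_subset _ hS _ (by simp)] at h
      have h' : ∑ w ∈ S, tmul A (contract (Finsupp.lapply w ∘ₗ g) (tmul A m c)) w =
          tmulHom A m (∑ w ∈ S, (g c) w • id w) := by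
        rw [map_sum]
        refine Finset.sum_congr rfl fun w _ => ?_
        rw [contract_tmul, smul_tmul]; rfl
      rw [h', h]; rfl
    | add x y hx hy =>
      obtain ⟨F, hF⟩ := hx
      obtain ⟨G, hG⟩ := hy
      refine ⟨F ∪ G, fun g hg => ?_⟩
      obtain ⟨S, hS⟩ := hF g fun x hx => hg x (Finset.mem_union_left _ hx)
      obtain ⟨T, hT⟩ := hG g fun x hx => hg x (Finset.mem_union_right _ hx)
      refine ⟨S ∪ T, fun U hU => ?_⟩
      simp only [map_add, add_tmul, Finset.sum_add_distrib]
      rw [← hS U (Finset.union_subset_left hU), ← hT U (Finset.union_subset_right hU)]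
  obtain ⟨F, hF⟩ := key z
  obtain ⟨g, hg⟩ := hC (Submodule.span A (F : Set C)) ⟨F, rfl⟩ (C →₀ A) C
    (Finsupp.linearCombination A id) LinearMap.id
    (fun c => ⟨Finsupp.single c 1, by simp⟩)
  obtain ⟨S, hS⟩ := hF g fun x hx => (hg x (Submodule.subset_span hx)).symm
  exact ⟨S, fun w => Finsupp.lapply w ∘ₗ g, hS S subset_rfl⟩

/-- The `α`-condition: elements of `M ⊗_A C` are separated by the left dual of `C`. -/
theorem LocallyProjective.ext (hC : LocallyProjective A C) {M : Type*} [AddCommGroup M]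
    [Module Aᵐᵒᵖ M] {z w : TensorOver A M C}
    (h : ∀ f : LeftDual A C, contract f.toLin z = contract f.toLin w) : z = w := by
  rw [← sub_eq_zero]
  obtain ⟨S, f, hf⟩ := hC.exists_sum (z - w)
  rw [hf]
  refine Finset.sum_eq_zero fun c _ => ?_
  have := h (f c)
  change contract (f c) z = contract (f c) w at this
  rw [map_sub, this, sub_self, zero_tmul]

theorem LocallyProjective.exists_lift (hC : LocallyProjective A C) {K X : Type*}
    [AddCommGroup K] [Module Aᵐᵒᵖ K] [AddCommGroup X] [Module Aᵐᵒᵖ X] (u : K →+ X)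
    (hu : ∀ (a : A) k, u (op a • k) = op a • u k) (z : TensorOver A X C)
    (hz : ∀ f : LeftDual A C, ∃ k, u k = contract f.toLin z) :
    ∃ w : TensorOver A K C, map u (AddMonoidHom.id C) hu idHom_smul w = z := by
  obtain ⟨S, f, hf⟩ := hC.exists_sum z
  choose k hk using fun c => hz (f c)
  refine ⟨∑ c ∈ S, tmul A (k c) c, ?_⟩
  refine Eq.trans ?_ hf.symm
  rw [map_sum]
  refine Finset.sum_congr rfl fun c _ => ?_
  rw [map_tmul, hk]
  rfl

variable [Module Aᵐᵒᵖ C] [SMulCommClass A Aᵐᵒᵖ C] [Coring A C]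

theorem contract_ofBaseFun {M : Type*} [AddCommGroup M] [Module Aᵐᵒᵖ M] (a : A)
    (f : LeftDual A C) (z : TensorOver A M C) :
    contract (LeftDual.ofBase A C a * f).toLin z = contract f.toLin (op a • z) := by
  refine contract_ofBase _ _ a (fun c => ?_) z
  rw [LeftDual.mul_toLin]
  exact congrArg f.toLin (act_ofBaseFun a c)

section TensorCoact

variable {B N P Q : Type*} [Ring B] [AddCommGroup N] [Module Bᵐᵒᵖ N] [AddCommGroup P]
  [Module B P] [Module Aᵐᵒᵖ P] [SMulCommClass B Aᵐᵒᵖ P] [AddCommGroup Q] [Module A Q]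

theorem tmulHom_op_smul (n : N) (a : A) (p : P) :
    tmulHom B n (op a • p) = op a • tmulHom B n p := (right_smul_tmul a n p).symm

/-- The map `P ⊗_A Q → (N ⊗_B P) ⊗_A Q`, `p ⊗ q ↦ (n ⊗ p) ⊗ q`. -/
def insertLeft (n : N) : TensorOver A P Q →+ TensorOver A (TensorOver B N P) Q :=
  map (tmulHom B n) (AddMonoidHom.id Q) (tmulHom_op_smul n) idHom_smul

theorem insertLeft_tmul (n : N) (p : P) (q : Q) :
    insertLeft n (tmul A p q) = tmul A (tmul B n p) q := map_tmul _ _ _ _ _ _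

/-- The map `N ⊗_B P → (N ⊗_B P) ⊗_A Q`, `n ⊗ p ↦ ∑ (n ⊗ p₀) ⊗ p₁`, induced by a left `B`-linear
map `P → P ⊗_A Q`, `p ↦ ∑ p₀ ⊗ p₁`. -/
def tensorCoact (N : Type*) [AddCommGroup N] [Module Bᵐᵒᵖ N] (ρ : P →+ TensorOver A P Q)
    (hρ : ∀ (b : B) p, ρ (b • p) = b • ρ p) :
    TensorOver B N P →+ TensorOver A (TensorOver B N P) Q :=
  lift (AddMonoidHom.mk' (fun n => (insertLeft n).comp ρ)
      (fun n n' => by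
        ext p
        simp only [AddMonoidHom.comp_apply, AddMonoidHom.add_apply]
        generalize ρ p = z
        induction z using TensorOver.induction_on with
        | zero => simp only [map_zero, add_zero]
        | tmul m q => simp only [insertLeft_tmul, add_tmul]
        | add x y hx hy => rw [map_add, hx, hy, map_add, map_add]; abel))
    (by
      intro n b p
      simp only [AddMonoidHom.mk'_apply, AddMonoidHom.comp_apply, hρ]
      generalize ρ p = z
      induction z using TensorOver.induction_on with
      | zero => simp only [smul_zero, map_zero]
      | tmul m q => rw [left_smul_tmul, insertLeft_tmul, insertLeft_tmul, smul_tmul]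
      | add x y hx hy => simp only [smul_add, map_add, hx, hy])

theorem tensorCoact_tmul (ρ : P →+ TensorOver A P Q)
    (hρ : ∀ (b : B) p, ρ (b • p) = b • ρ p) (n : N) (p : P) :
    tensorCoact N ρ hρ (tmul B n p) = insertLeft n (ρ p) := by
  rw [tensorCoact, lift_tmul]; rfl

theorem assoc_tensorCoact (ρ : P →+ TensorOver A P Q)
    (hρ : ∀ (b : B) p, ρ (b • p) = b • ρ p) (x : TensorOver B N P) :
    assoc (tensorCoact N ρ hρ x) = map (AddMonoidHom.id N) ρ idHom_op_smul hρ x := by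
  induction x using TensorOver.induction_on with
  | zero => simp only [map_zero]
  | tmul n p =>
    rw [tensorCoact_tmul, map_tmul]
    generalize ρ p = z
    induction z using TensorOver.induction_on with
    | zero => simp only [map_zero, tmul_zero]
    | tmul m q => rw [insertLeft_tmul, assoc_tmul]; rfl
    | add x y hx hy => simp only [map_add, hx, hy, tmul_add]
  | add x y hx hy => simp only [map_add, hx, hy]

theorem contract_tensorCoact (ρ : P →+ TensorOver A P Q)
    (hρ : ∀ (b : B) p, ρ (b • p) = b • ρ p) (f : Q →ₗ[A] A) (u : P →+ P)
    (hu : ∀ (b : B) p, u (b • p) = b • u p) (h : ∀ p, contract f (ρ p) = u p)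
    (x : TensorOver B N P) :
    contract f (tensorCoact N ρ hρ x) = map (AddMonoidHom.id N) u idHom_op_smul hu x := by
  induction x using TensorOver.induction_on with
  | zero => simp only [map_zero]
  | tmul n p =>
    rw [tensorCoact_tmul, map_tmul, ← h, insertLeft, contract_map _ _ _ _ f f (fun _ => rfl)]
    rfl
  | add x y hx hy => simp only [map_add, hx, hy]

/-- If `N` is an `(S, B)`-bimodule, then the map induced on `N ⊗_B P` is left `S`-linear. -/
theorem tensorCoact_smul {S : Type*} [Ring S] [Module S N] [SMulCommClass S Bᵐᵒᵖ N]
    (ρ : P →+ TensorOver A P Q) (hρ : ∀ (b : B) p, ρ (b • p) = b • ρ p) (s : S)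
    (x : TensorOver B N P) : tensorCoact N ρ hρ (s • x) = s • tensorCoact N ρ hρ x := by
  induction x using TensorOver.induction_on with
  | zero => simp only [map_zero, smul_zero]
  | tmul n p =>
    rw [left_smul_tmul, tensorCoact_tmul, tensorCoact_tmul]
    generalize ρ p = z
    induction z using TensorOver.induction_on with
    | zero => simp only [map_zero, smul_zero]
    | tmul m q => simp only [insertLeft_tmul, left_smul_tmul]
    | add x y hx hy => simp only [map_add, hx, hy, smul_add]
  | add x y hx hy => simp only [map_add, hx, hy, smul_add]

end TensorCoact

/-- If `C` is locally projective, a right module over the left dual of `C` with a map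
`ρ : K → K ⊗_A C` such that `k f = ∑ k₀ f(k₁)`, where `ρ(k) = ∑ k₀ ⊗ k₁`, is a comodule with
coaction `ρ`. -/
def Comod.ofRational (hC : LocallyProjective A C) (K : Type u) [AddCommGroup K] [Module Aᵐᵒᵖ K]
    [Module (LeftDual A C)ᵐᵒᵖ K]
    (hA : ∀ (a : A) (k : K), op a • k = op (LeftDual.ofBase A C a) • k)
    (ρ : K → TensorOver A K C)
    (hρ : ∀ (f : LeftDual A C) (k : K), contract f.toLin (ρ k) = op f • k) : Comod A C where
  carrier := K
  coact :=
    { toFun := ρ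
      map_add' := fun k k' => hC.ext fun f => by simp only [map_add, hρ, smul_add]
      map_smul' := fun a k => hC.ext fun f => by
        obtain ⟨a, rfl⟩ := op_surjective a
        rw [RingHom.id_apply, ← contract_ofBaseFun, hρ, hρ, hA, ← mul_smul, ← op_mul] }
  coassoc k := by
    rw [← assoc_tensorCoact _ (toAdd_smul Coring.comul)]
    refine congrArg _ (hC.ext fun f => hC.ext fun g => ?_)
    rw [contract_map _ _ _ _ f.toLin f.toLin (fun _ => rfl),
      contract_tensorCoact _ _ f.toLin (act f).toAddMonoidHom (toAdd_smul (act f)) (fun _ => rfl),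
      contract_map _ _ _ _ g.toLin (f * g).toLin (fun _ => rfl)]
    change contract g.toLin (ρ (contract f.toLin (ρ k))) = contract (f * g).toLin (ρ k)
    rw [hρ, hρ, hρ, op_mul, mul_smul]
  counit k := by
    have := hρ 1 k
    rwa [op_one, one_smul] at this

/-- If `C` is locally projective, maps commuting with the action of the left dual are
colinear. -/
theorem colinear_of_act (hC : LocallyProjective A C) (M N : Comod A C) (u : M →ₗ[Aᵐᵒᵖ] N)
    (hu : ∀ (f : LeftDual A C) m,
      u (contract f.toLin (M.coact m)) = contract f.toLin (N.coact (u m))) (m : M) :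
    N.coact (u m) = map u.toAddMonoidHom (AddMonoidHom.id C)
      (toAdd_op_smul u fun a => u.map_smul (op a)) idHom_smul (M.coact m) :=
  hC.ext fun f => by
    rw [contract_map _ _ _ _ f.toLin f.toLin (fun _ => rfl), ← hu]; rfl

/-- A right module over the left dual of `C`, seen as a right `A`-module by restriction of
scalars along `A → Hom_{A-}(C, A)`. -/
def RestrictBase (A C M : Type u) [Ring A] [AddCommGroup C] [Module A C] : Type u := M

section Restrict

variable {M : Type u} [AddCommGroup M] [Module (LeftDual A C)ᵐᵒᵖ M]

instance : AddCommGroup (RestrictBase A C M) := inferInstanceAs (AddCommGroup M)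

instance : Module (LeftDual A C)ᵐᵒᵖ (RestrictBase A C M) :=
  inferInstanceAs (Module (LeftDual A C)ᵐᵒᵖ M)

instance : Module Aᵐᵒᵖ (RestrictBase A C M) :=
  Module.compHom M (LeftDual.ofBase A C).op

theorem restrict_smul (a : A) (m : RestrictBase A C M) :
    op a • m = op (LeftDual.ofBase A C a) • m := rfl

variable (A C M) in
/-- The rational part of a right module `M` over the left dual of `C`: the elements `m` for which
there is `∑ mᵢ ⊗ cᵢ` in `M ⊗_A C` with `m f = ∑ mᵢ f(cᵢ)` for all `f`. -/
def rat : Submodule (LeftDual A C)ᵐᵒᵖ (RestrictBase A C M) where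
  carrier := {m | ∃ z : TensorOver A (RestrictBase A C M) C, ∀ f : LeftDual A C,
    op f • m = contract f.toLin z}
  add_mem' := by
    rintro m n ⟨z, hz⟩ ⟨w, hw⟩
    exact ⟨z + w, fun f => by rw [smul_add, map_add, hz, hw]⟩
  zero_mem' := ⟨0, fun f => by rw [smul_zero, map_zero]⟩
  smul_mem' := by
    rintro g m ⟨z, hz⟩
    obtain ⟨g, rfl⟩ := op_surjective g
    refine ⟨map (AddMonoidHom.id _) (act g).toAddMonoidHom idHom_op_smul
      (toAdd_smul (act g)) z, fun f => ?_⟩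
    rw [contract_map _ _ _ _ f.toLin (g * f).toLin (fun _ => rfl), ← mul_smul, ← op_mul, hz]
    rfl

/-- The inclusion of the rational part. -/
def ratIncl : RestrictBase A C (rat A C M) →+ RestrictBase A C M :=
  (rat A C M).subtype.toAddMonoidHom

theorem ratIncl_smul (a : A) (m : RestrictBase A C (rat A C M)) :
    ratIncl (op a • m) = op a • ratIncl m := rfl

theorem exists_ratCoact (hC : LocallyProjective A C) (m : RestrictBase A C (rat A C M)) :
    ∃ w : TensorOver A (RestrictBase A C (rat A C M)) C, ∀ f : LeftDual A C,
      contract f.toLin w = op f • m := by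
  obtain ⟨z, hz⟩ := m.2
  obtain ⟨w, hw⟩ := hC.exists_lift ratIncl ratIncl_smul z (fun f => ⟨op f • m, hz f⟩)
  refine ⟨w, fun f => Subtype.ext (Eq.trans ?_ (hz f).symm)⟩
  rw [← hw, contract_map _ _ _ _ f.toLin f.toLin (fun _ => rfl)]
  rfl

variable (M) in
/-- The comodule structure on the rational part of `M`: the coaction sends `m` to the unique
element `∑ mᵢ ⊗ cᵢ` with `m f = ∑ mᵢ f(cᵢ)` for all `f`. -/
noncomputable def ratComod (hC : LocallyProjective A C) : Comod A C :=
  Comod.ofRational hC (RestrictBase A C (rat A C M)) restrict_smul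
    (fun m => (exists_ratCoact hC m).choose) (fun f m => (exists_ratCoact hC m).choose_spec f)

theorem contract_ratComod (hC : LocallyProjective A C) (f : LeftDual A C)
    (m : RestrictBase A C (rat A C M)) :
    contract (M := RestrictBase A C (rat A C M)) f.toLin ((ratComod M hC).coact m) =
      op f • m :=
  (exists_ratCoact hC m).choose_spec f

/-- A linear map, seen as an additive map between the restrictions. -/
def restrictMap {N : Type u} [AddCommGroup N] [Module (LeftDual A C)ᵐᵒᵖ N]
    (u : M →ₗ[(LeftDual A C)ᵐᵒᵖ] N) : RestrictBase A C M →+ RestrictBase A C N :=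
  u.toAddMonoidHom

theorem restrictMap_op_smul {N : Type u} [AddCommGroup N] [Module (LeftDual A C)ᵐᵒᵖ N]
    (u : M →ₗ[(LeftDual A C)ᵐᵒᵖ] N) (a : A) (m : RestrictBase A C M) :
    restrictMap u (op a • m) = op a • restrictMap u m :=
  u.map_smul (op (LeftDual.ofBase A C a)) m

theorem restrictMap_mem {N : Type u} [AddCommGroup N] [Module (LeftDual A C)ᵐᵒᵖ N]
    (u : M →ₗ[(LeftDual A C)ᵐᵒᵖ] N) {m : RestrictBase A C M} (hm : m ∈ rat A C M) :
    restrictMap u m ∈ rat A C N := by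
  obtain ⟨z, hz⟩ := hm
  refine ⟨map (restrictMap u) (AddMonoidHom.id C) (restrictMap_op_smul u) idHom_smul z,
    fun f => ?_⟩
  rw [contract_map _ _ _ _ f.toLin f.toLin (fun _ => rfl), ← hz]
  exact (u.map_smul (op f) m).symm

end Restrict

/-- The rational part of a right module over the left dual, as a functor to comodules. -/
noncomputable def ratFunctor (hC : LocallyProjective A C) :
    ModuleCat.{u} (LeftDual A C)ᵐᵒᵖ ⥤ Comod A C where
  obj M := ratComod M hC
  map {M N} u :=
    let v : rat A C M →ₗ[(LeftDual A C)ᵐᵒᵖ] rat A C N :=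
      { toFun := fun m => ⟨restrictMap u.hom m.1, restrictMap_mem u.hom m.2⟩
        map_add' := fun _ _ => Subtype.ext (u.hom.map_add _ _)
        map_smul' := fun _ _ => Subtype.ext (u.hom.map_smul _ _) }
    let w : ratComod M hC →ₗ[Aᵐᵒᵖ] ratComod N hC :=
      { toFun := v
        map_add' := v.map_add
        map_smul' := fun a m => v.map_smul (op (LeftDual.ofBase A C (unop a))) m }
    ⟨w, colinear_of_act hC _ _ w fun f m =>
      (congrArg v (contract_ratComod hC f m)).trans
        ((v.map_smul (op f) m).trans (contract_ratComod hC f (v m)).symm)⟩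
  map_id _ := Comod.hom_ext fun _ => Subtype.ext rfl
  map_comp _ _ := Comod.hom_ext fun _ => Subtype.ext rfl

/-- The underlying module of a right comodule, as a right module over the left dual of `C`. -/
def Comod.AsModule (M : Comod A C) : Type u := M

instance (M : Comod A C) : AddCommGroup M.AsModule := inferInstanceAs (AddCommGroup M)

theorem Comod.contract_coact_contract (M : Comod A C) (f g : LeftDual A C) (m : M) :
    contract g.toLin (M.coact (contract f.toLin (M.coact m))) =
      contract (f * g).toLin (M.coact m) := by
  have h := coact_contract M.coact.toAddMonoidHom
    (toAdd_op_smul M.coact fun a => M.coact.map_smul (op a)) M.coassoc f m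
  change M.coact (contract f.toLin (M.coact m)) = _ at h
  rw [h, contract_map _ _ _ _ g.toLin (f * g).toLin (fun _ => rfl)]
  rfl

/-- The map `m ↦ ∑ m₀ f(m₁)` on a right comodule. -/
def Comod.actHom (M : Comod A C) (f : LeftDual A C) : M →+ M :=
  (contract f.toLin).comp M.coact.toAddMonoidHom

/-- The action `m f = ∑ m₀ f(m₁)` of the left dual of `C` on a right comodule. -/
instance (M : Comod A C) : Module (LeftDual A C)ᵐᵒᵖ M.AsModule where
  smul f m := M.actHom (unop f) m
  one_smul m := M.counit m
  mul_smul f g m := (M.contract_coact_contract (unop g) (unop f) m).symm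
  smul_zero f := map_zero (M.actHom (unop f))
  smul_add f := map_add (M.actHom (unop f))
  add_smul _ _ m := contract_add_left (M := M) _ _ (M.coact m)
  zero_smul m := contract_zero_left (M := M) (M.coact m)

theorem Comod.Hom.actHom {M N : Comod A C} (u : M ⟶ N) (f : LeftDual A C) (m : M) :
    Comod.Hom.toLin u (M.actHom f m) = N.actHom f (Comod.Hom.toLin u m) := by
  change Comod.Hom.toLin u (contract f.toLin (M.coact m)) =
    contract f.toLin (N.coact (Comod.Hom.toLin u m))
  rw [Comod.Hom.colinear u m, contract_map _ _ _ _ f.toLin f.toLin (fun _ => rfl)]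
  rfl

/-- A colinear map as a map of the associated modules. -/
def Comod.Hom.asModuleMap {M N : Comod A C} (u : Comod.Hom M N) : M.AsModule →+ N.AsModule :=
  u.toLin.toAddMonoidHom

variable (A C) in
/-- The functor from right comodules to right modules over the left dual of `C`. -/
def comodToModule : Comod A C ⥤ ModuleCat.{u} (LeftDual A C)ᵐᵒᵖ where
  obj M := ModuleCat.of _ M.AsModule
  map {M N} u := ModuleCat.ofHom (X := M.AsModule) (Y := N.AsModule)
    { Comod.Hom.asModuleMap u with
      map_smul' := fun f m => Comod.Hom.actHom u (unop f) m }

end Rational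

/-! ### Morphisms of corings and the coinduction functor -/

section Coinduction

variable {A B : Type u} [Ring A] [Ring B] (β : A →+* B)
  (C D : Type u) [AddCommGroup C] [Module A C] [Module Aᵐᵒᵖ C] [SMulCommClass A Aᵐᵒᵖ C]
  [Coring A C] [AddCommGroup D] [Module B D] [Module Bᵐᵒᵖ D] [SMulCommClass B Bᵐᵒᵖ D]
  [Coring B D]

/-- A morphism of corings `(θ : β) : (C : A) → (D : B)` over a ring morphism `β : A → B`. -/
structure CoringHom where
  /-- The map `θ : C → D`. -/
  toHom : C →+ D
  map_smul : ∀ (a : A) (c : C), toHom (a • c) = β a • toHom c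
  map_op_smul : ∀ (a : A) (c : C), toHom (op a • c) = op (β a) • toHom c
  comul_toHom : ∀ c : C, Coring.comul (A := B) (toHom c) =
    mapSemi β toHom toHom map_op_smul map_smul (Coring.comul (A := A) c)
  counit_toHom : ∀ c : C, Coring.counit (A := B) (toHom c) = β (Coring.counit (A := A) c)

variable {β C D}

/-- The bimodule `Hom_{A-}(C, B)` of left `A`-linear maps, for a morphism of corings
`(θ : β) : (C : A) → (D : B)`. -/
def SharpDual (_θ : CoringHom β C D) : Type u := C →ₛₗ[β] B

namespace SharpDual

variable {θ : CoringHom β C D}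

instance : AddCommGroup (SharpDual θ) := inferInstanceAs (AddCommGroup (C →ₛₗ[β] B))

/-- An element of `Hom_{A-}(C, B)` as a semilinear map. -/
def toLin (h : SharpDual θ) : C →ₛₗ[β] B := h

theorem ext {f g : SharpDual θ} (h : ∀ c, f.toLin c = g.toLin c) : f = g :=
  LinearMap.ext h

theorem add_toLin (f g : SharpDual θ) (c : C) : (f + g).toLin c = f.toLin c + g.toLin c := rfl

theorem zero_toLin (c : C) : (0 : SharpDual θ).toLin c = 0 := rfl

/-- The map `C ⊗_A C → D`, `c ⊗ c' ↦ θ(c) h(c')`. -/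
def twistAux (h : SharpDual θ) : TensorOver A C C →+ D :=
  lift (AddMonoidHom.mk' (fun c => AddMonoidHom.mk' (fun c' => op (h.toLin c') • θ.toHom c)
      (fun x y => by simp [add_smul])) (fun x y => by ext; simp))
    (by intro x a y; simp [θ.map_op_smul, mul_smul])

theorem twistAux_tmul (h : SharpDual θ) (c c' : C) :
    h.twistAux (tmul A c c') = op (h.toLin c') • θ.toHom c := by
  rw [twistAux, lift_tmul]; rfl

theorem twistAux_smul (h : SharpDual θ) (a : A) (z : TensorOver A C C) :
    h.twistAux (a • z) = β a • h.twistAux z := by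
  induction z using TensorOver.induction_on with
  | zero => simp only [map_zero, smul_zero]
  | tmul c c' => rw [left_smul_tmul, twistAux_tmul, twistAux_tmul, θ.map_smul, smul_comm (β a)]
  | add x y hx hy => simp only [smul_add, map_add, hx, hy]

/-- The map `C → D`, `c ↦ ∑ θ(c₁) h(c₂)`. -/
def twist (h : SharpDual θ) : C →+ D :=
  h.twistAux.comp (Coring.comul (A := A)).toAddMonoidHom

theorem twist_apply (h : SharpDual θ) (c : C) :
    h.twist c = h.twistAux (Coring.comul (A := A) c) := rfl

theorem twist_smul (h : SharpDual θ) (a : A) (c : C) : h.twist (a • c) = β a • h.twist c := by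
  rw [twist_apply, LinearMap.map_smul, twistAux_smul]; rfl

theorem comul_twist (h : SharpDual θ) (c : C) : Coring.comul (A := B) (h.twist c) =
    mapSemi β θ.toHom h.twist θ.map_op_smul h.twist_smul (Coring.comul (A := A) c) := by
  have key : ∀ z : TensorOver A C C, Coring.comul (A := B) (h.twistAux z) =
      mapSemi β θ.toHom h.twistAux θ.map_op_smul h.twistAux_smul
        (assoc (map (Coring.comul (A := A) (C := C)).toAddMonoidHom (AddMonoidHom.id C)
          (toAdd_op_smul Coring.comul Coring.comul_op_smul) idHom_smul z)) := by
    intro z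
    induction z using TensorOver.induction_on with
    | zero => simp only [map_zero]
    | tmul c w =>
      rw [twistAux_tmul, Coring.comul_op_smul, θ.comul_toHom, map_tmul]
      change _ = mapSemi β _ _ _ _ (assoc (tmul A (Coring.comul (A := A) c) w))
      generalize Coring.comul (A := A) c = x
      induction x using TensorOver.induction_on with
      | zero => simp only [map_zero, smul_zero, zero_tmul]
      | tmul m n =>
        rw [assoc_tmul, mapSemi_tmul, mapSemi_tmul, right_smul_tmul, twistAux_tmul]
      | add x y hx hy => simp only [map_add, smul_add, add_tmul, hx, hy]
    | add x y hx hy => simp only [map_add, hx, hy]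
  rw [twist_apply, key, Coring.coassoc]
  generalize Coring.comul (A := A) c = z
  induction z using TensorOver.induction_on with
  | zero => simp only [map_zero]
  | tmul m n => rw [map_tmul, mapSemi_tmul, mapSemi_tmul]; rfl
  | add x y hx hy => simp only [map_add, hx, hy]

/-- The right action `(h g)(c) = ∑ g(θ(c₁) h(c₂))` of the left dual of `D`. -/
def rightAct (g : LeftDual B D) (h : SharpDual θ) : SharpDual θ :=
  { toFun := fun c => g.toLin (h.twist c)
    map_add' := fun c c' => by rw [map_add, map_add]
    map_smul' := fun a c => by rw [twist_smul, LinearMap.map_smul] }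

theorem rightAct_toLin (g : LeftDual B D) (h : SharpDual θ) (c : C) :
    (rightAct g h).toLin c = g.toLin (h.twist c) := rfl

theorem act_twist (g : LeftDual B D) (h : SharpDual θ) (c : C) :
    act g (h.twist c) = (rightAct g h).twist c := by
  rw [act_apply, comul_twist, twist_apply]
  generalize Coring.comul (A := A) c = z
  induction z using TensorOver.induction_on with
  | zero => simp only [map_zero]
  | tmul m n => rw [mapSemi_tmul, contract_tmul, twistAux_tmul]; rfl
  | add x y hx hy => simp only [map_add, hx, hy]

theorem counit_twist (h : SharpDual θ) (c : C) :
    Coring.counit (A := B) (h.twist c) = h.toLin c := by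
  have key : ∀ z : TensorOver A C C, Coring.counit (A := B) (h.twistAux z) =
      h.toLin (contractLeft (Coring.counit (A := A)).toAddMonoidHom
        (toAdd_op_smul_mul Coring.counit Coring.counit_op_smul) z) := by
    intro z
    induction z using TensorOver.induction_on with
    | zero => simp only [map_zero]
    | tmul m n =>
      rw [twistAux_tmul, contractLeft_tmul, Coring.counit_op_smul, θ.counit_toHom,
        LinearMap.map_smulₛₗ]
      rfl
    | add x y hx hy => simp only [map_add, hx, hy]
  rw [twist_apply, key, Coring.counit_comul]

theorem twist_add (h h' : SharpDual θ) (c : C) : (h + h').twist c = h.twist c + h'.twist c := by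
  rw [twist_apply, twist_apply, twist_apply]
  generalize Coring.comul (A := A) c = z
  induction z using TensorOver.induction_on with
  | zero => simp only [map_zero, add_zero]
  | tmul m n => rw [twistAux_tmul, twistAux_tmul, twistAux_tmul, add_toLin, op_add, add_smul]
  | add x y hx hy => simp only [map_add, hx, hy]; abel

theorem twist_zero (c : C) : (0 : SharpDual θ).twist c = 0 := by
  rw [twist_apply]
  generalize Coring.comul (A := A) c = z
  induction z using TensorOver.induction_on with
  | zero => simp only [map_zero]
  | tmul m n => rw [twistAux_tmul, zero_toLin, op_zero, zero_smul]
  | add x y hx hy => simp only [map_add, hx, hy, add_zero]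

theorem twist_act (φ : LeftDual A C) (h h' : SharpDual θ)
    (hh : ∀ c, h'.toLin c = h.toLin (act φ c)) (c : C) : h.twist (act φ c) = h'.twist c := by
  rw [twist_apply, twist_apply, comul_act]
  generalize Coring.comul (A := A) c = z
  induction z using TensorOver.induction_on with
  | zero => simp only [map_zero]
  | tmul m n => rw [map_tmul, twistAux_tmul, twistAux_tmul, hh]; rfl
  | add x y hx hy => simp only [map_add, hx, hy]

/-- `Hom_{A-}(C, B)` is a right module over the left dual of `D`, by
`(h g)(c) = ∑ g(θ(c₁) h(c₂))`. -/
instance : Module (LeftDual B D)ᵐᵒᵖ (SharpDual θ) where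
  smul g h := rightAct (unop g) h
  one_smul h := ext fun c => counit_twist h c
  mul_smul g g' h := ext fun c => by
    change (unop (g * g')).toLin (h.twist c) =
      (unop g).toLin ((rightAct (unop g') h).twist c)
    rw [← act_twist]; rfl
  smul_zero g := ext fun c => by
    change (unop g).toLin ((0 : SharpDual θ).twist c) = 0
    rw [twist_zero, map_zero]
  smul_add g h h' := ext fun c => by
    change (unop g).toLin ((h + h').twist c) =
      (unop g).toLin (h.twist c) + (unop g).toLin (h'.twist c)
    rw [twist_add, map_add]
  add_smul g g' h := rfl
  zero_smul h := rfl

/-- `Hom_{A-}(C, B)` is a left module over the left dual of `C`, by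
`(φ h)(c) = ∑ h(c₁ φ(c₂))`. -/
instance : Module (LeftDual A C) (SharpDual θ) where
  smul φ h := h.toLin.comp (act φ)
  one_smul h := ext fun c => congrArg h.toLin (act_one c)
  mul_smul φ ψ h := ext fun c => congrArg h.toLin (act_mul φ ψ c)
  smul_zero _ := rfl
  smul_add _ _ _ := rfl
  add_smul φ ψ h := ext fun c =>
    (congrArg h.toLin (act_add φ ψ c)).trans (map_add h.toLin _ _)
  zero_smul h := ext fun c => (congrArg h.toLin (act_zero c)).trans (map_zero h.toLin)

theorem op_smul_toLin (g : LeftDual B D) (h : SharpDual θ) (c : C) :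
    (op g • h).toLin c = g.toLin (h.twist c) := rfl

theorem smul_toLin (φ : LeftDual A C) (h : SharpDual θ) (c : C) :
    (φ • h).toLin c = h.toLin (act φ c) := rfl

instance : SMulCommClass (LeftDual A C) (LeftDual B D)ᵐᵒᵖ (SharpDual θ) where
  smul_comm φ g h := ext fun c =>
    congrArg (unop g).toLin (twist_act φ h (φ • h) (fun _ => rfl) c)

end SharpDual

namespace CoringHom

variable (θ : CoringHom β C D)

/-- The map `β ∘ - : Hom_{A-}(C, A) → Hom_{A-}(C, B)`. -/
def postComp : LeftDual A C →+ SharpDual θ where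
  toFun f :=
    { toFun := fun c => β (f.toLin c)
      map_add' := fun c c' => by rw [map_add, map_add]
      map_smul' := fun a c => by rw [LinearMap.map_smul, smul_eq_mul, map_mul]; rfl }
  map_zero' := SharpDual.ext fun _ => map_zero β
  map_add' f g := SharpDual.ext fun c => map_add β (f.toLin c) (g.toLin c)

/-- The map `- ∘ θ : Hom_{B-}(D, B) → Hom_{A-}(C, B)`. -/
def preComp : LeftDual B D →+ SharpDual θ where
  toFun g :=
    { toFun := fun c => g.toLin (θ.toHom c)
      map_add' := fun c c' => by rw [map_add, map_add]
      map_smul' := fun a c => by rw [θ.map_smul, LinearMap.map_smul] }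
  map_zero' := rfl
  map_add' _ _ := rfl

/-- The image of `β ∘ -` in `Hom_{A-}(C, B)`. -/
def sharpC : AddSubgroup (SharpDual θ) := θ.postComp.range

/-- The image of `- ∘ θ` in `Hom_{A-}(C, B)`. -/
def sharpD : AddSubgroup (SharpDual θ) := θ.preComp.range

/-- A morphism of corings is compatible if the image of `- ∘ θ` is contained in the image of
`β ∘ -`. -/
def Compatible : Prop := θ.sharpD ≤ θ.sharpC

theorem postComp_toLin (f : LeftDual A C) (c : C) : (θ.postComp f).toLin c = β (f.toLin c) := rfl

theorem preComp_toLin (g : LeftDual B D) (c : C) :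
    (θ.preComp g).toLin c = g.toLin (θ.toHom c) := rfl

theorem smul_postComp (φ f : LeftDual A C) : φ • θ.postComp f = θ.postComp (φ * f) := rfl

theorem twist_postComp (φ : LeftDual A C) (c : C) :
    (θ.postComp φ).twist c = θ.toHom (act φ c) := by
  rw [SharpDual.twist_apply, act_apply]
  generalize Coring.comul (A := A) c = z
  induction z using TensorOver.induction_on with
  | zero => simp only [map_zero]
  | tmul m n =>
    rw [SharpDual.twistAux_tmul, contract_tmul, θ.map_op_smul]; rfl
  | add x y hx hy => simp only [map_add, hx, hy]

theorem op_smul_postComp (φ : LeftDual A C) (g : LeftDual B D) :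
    op g • θ.postComp φ = φ • θ.preComp g :=
  SharpDual.ext fun c => congrArg g.toLin (twist_postComp θ φ c)

variable {θ}

/-- For a compatible morphism, the image of `β ∘ -` is a right submodule over the left dual of
`D`. -/
def sharpCSub (hθ : θ.Compatible) : Submodule (LeftDual B D)ᵐᵒᵖ (SharpDual θ) where
  carrier := θ.sharpC
  add_mem' := θ.sharpC.add_mem
  zero_mem' := θ.sharpC.zero_mem
  smul_mem' := by
    rintro g _ ⟨φ, rfl⟩
    obtain ⟨g, rfl⟩ := op_surjective g
    obtain ⟨f, hf⟩ := hθ ⟨g, rfl⟩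
    refine ⟨φ * f, ?_⟩
    rw [op_smul_postComp, ← hf, smul_postComp]

theorem smul_mem_sharpC (hθ : θ.Compatible) (φ : LeftDual A C) {h : SharpDual θ}
    (hh : h ∈ sharpCSub hθ) : φ • h ∈ sharpCSub hθ := by
  obtain ⟨f, rfl⟩ := hh
  exact ⟨φ * f, rfl⟩

/-- The left action of the left dual of `C` on the image of `β ∘ -`. -/
def sharpAct (hθ : θ.Compatible) (φ : LeftDual A C) :
    sharpCSub hθ →ₗ[(LeftDual B D)ᵐᵒᵖ] sharpCSub hθ where
  toFun h := ⟨φ • h.1, smul_mem_sharpC hθ φ h.2⟩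
  map_add' h h' := Subtype.ext (smul_add φ h.1 h'.1)
  map_smul' g h := Subtype.ext (smul_comm φ g h.1)

/-- The group of right linear maps over the left dual of `D` from the image of `β ∘ -` to `N`. -/
def SharpHom (hθ : θ.Compatible) (N : Type u) [AddCommGroup N]
    [Module (LeftDual B D)ᵐᵒᵖ N] : Type u :=
  sharpCSub hθ →ₗ[(LeftDual B D)ᵐᵒᵖ] N

section SharpHom

variable (hθ : θ.Compatible) (N : Type u) [AddCommGroup N] [Module (LeftDual B D)ᵐᵒᵖ N]

instance : AddCommGroup (SharpHom hθ N) :=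
  inferInstanceAs (AddCommGroup (sharpCSub hθ →ₗ[(LeftDual B D)ᵐᵒᵖ] N))

variable {hθ N}

/-- An element of `SharpHom` as a linear map. -/
def SharpHom.toLin (x : SharpHom hθ N) : sharpCSub hθ →ₗ[(LeftDual B D)ᵐᵒᵖ] N := x

theorem SharpHom.ext {x y : SharpHom hθ N} (h : ∀ k, x.toLin k = y.toLin k) : x = y :=
  LinearMap.ext h

/-- The right action `(x φ)(h) = x(φ h)` of the left dual of `C`. -/
instance : Module (LeftDual A C)ᵐᵒᵖ (SharpHom hθ N) where
  smul φ x := x.toLin.comp (sharpAct hθ (unop φ))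
  one_smul x := SharpHom.ext fun h =>
    congrArg x.toLin (Subtype.ext (one_smul (LeftDual A C) h.1))
  mul_smul φ ψ x := SharpHom.ext fun h =>
    congrArg x.toLin (Subtype.ext (mul_smul (unop ψ) (unop φ) h.1))
  smul_zero _ := rfl
  smul_add _ _ _ := rfl
  add_smul φ ψ x := SharpHom.ext fun h => by
    have e : sharpAct hθ (unop (φ + ψ)) h = sharpAct hθ (unop φ) h + sharpAct hθ (unop ψ) h :=
      Subtype.ext (add_smul (unop φ) (unop ψ) h.1)
    exact (congrArg x.toLin e).trans (map_add x.toLin _ _)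
  zero_smul x := SharpHom.ext fun h => by
    have e : sharpAct hθ (unop 0) h = 0 := Subtype.ext (zero_smul (LeftDual A C) h.1)
    exact (congrArg x.toLin e).trans (map_zero x.toLin)

theorem SharpHom.op_smul_toLin (φ : LeftDual A C) (x : SharpHom hθ N) (h : sharpCSub hθ) :
    (op φ • x).toLin h = x.toLin (sharpAct hθ φ h) := rfl

/-- Composition with a linear map `N → N'`. -/
def SharpHom.map {N' : Type u} [AddCommGroup N'] [Module (LeftDual B D)ᵐᵒᵖ N']
    (u : N →ₗ[(LeftDual B D)ᵐᵒᵖ] N') :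
    SharpHom hθ N →ₗ[(LeftDual A C)ᵐᵒᵖ] SharpHom hθ N' where
  toFun x := u.comp x.toLin
  map_add' _ _ := SharpHom.ext fun _ => map_add u _ _
  map_smul' _ _ := rfl

end SharpHom

/-- The functor `N ↦ Hom(_#C, N)` from right modules over the left dual of `D` to right modules
over the left dual of `C`, where `_#C` is the image of `β ∘ -`. -/
def homFunctor (hθ : θ.Compatible) :
    ModuleCat.{u} (LeftDual B D)ᵐᵒᵖ ⥤ ModuleCat.{u} (LeftDual A C)ᵐᵒᵖ where
  obj N := ModuleCat.of _ (SharpHom hθ N)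
  map u := ModuleCat.ofHom (SharpHom.map u.hom)

/-- The coinduction functor `N ↦ Rat(Hom(_#C, N))` from right `D`-comodules to right
`C`-comodules. -/
noncomputable def coind (hC : LocallyProjective A C) (hθ : θ.Compatible) :
    Comod B D ⥤ Comod A C :=
  comodToModule B D ⋙ homFunctor hθ ⋙ ratFunctor hC

end CoringHom

end Coinduction

/-! ### The cotensor product and the ad-induction functor -/

section Cotensor

/-- The cotensor product `M □_D N` of a right coaction `ρ : M → M ⊗_B D` and a left coaction
`σ : N → D ⊗_B N`: the kernel of `ρ ⊗ id - id ⊗ σ` in `M ⊗_B N`. -/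
def cotensor {B D M N : Type*} [Ring B] [AddCommGroup D] [Module B D] [Module Bᵐᵒᵖ D]
    [SMulCommClass B Bᵐᵒᵖ D] [AddCommGroup M] [Module Bᵐᵒᵖ M] [AddCommGroup N] [Module B N]
    (ρ : M →+ TensorOver B M D) (hρ : ∀ (b : B) m, ρ (op b • m) = op b • ρ m)
    (σ : N →+ TensorOver B D N) (hσ : ∀ (b : B) n, σ (b • n) = b • σ n) :
    AddSubgroup (TensorOver B M N) :=
  (assoc.comp (map ρ (AddMonoidHom.id N) hρ idHom_smul) -
    map (AddMonoidHom.id M) σ idHom_op_smul hσ).ker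

variable {A B : Type u} [Ring A] [Ring B] {β : A →+* B}
  {C D : Type u} [AddCommGroup C] [Module A C] [Module Aᵐᵒᵖ C] [SMulCommClass A Aᵐᵒᵖ C]
  [Coring A C] [AddCommGroup D] [Module B D] [Module Bᵐᵒᵖ D] [SMulCommClass B Bᵐᵒᵖ D]
  [Coring B D]

/-- The ring `B` as a `(B, A)`-bimodule, `A` acting through `β : A → B`. -/
def RightRestrict (_β : A →+* B) : Type u := B

namespace RightRestrict

instance : AddCommGroup (RightRestrict β) := inferInstanceAs (AddCommGroup B)
instance : Module B (RightRestrict β) := inferInstanceAs (Module B B)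
instance : Module Aᵐᵒᵖ (RightRestrict β) := Module.compHom B β.op
instance : SMulCommClass B Aᵐᵒᵖ (RightRestrict β) where
  smul_comm b a x := smul_comm (M := B) (N := Bᵐᵒᵖ) (α := B) b (op (β (unop a))) x

variable (β) in
/-- The unit of `B`. -/
def one : RightRestrict β := (1 : B)

theorem op_smul_one (a : A) : op a • one β = β a • one β := by
  change (1 : B) * β a = β a * 1
  rw [one_mul, mul_one]

end RightRestrict

namespace CoringHom

variable (β C) in
/-- The `(B, A)`-bimodule `B ⊗_A C`. -/
abbrev BaseTensor : Type u := TensorOver A (RightRestrict β) C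

variable (θ : CoringHom β C D)

/-- The map `C ⊗_A C → D ⊗_B (B ⊗_A C)`, `c ⊗ c' ↦ θ(c) ⊗ (1 ⊗ c')`. -/
def leftCoactAux : TensorOver A C C →+ TensorOver B D (BaseTensor β C) :=
  lift (AddMonoidHom.mk' (fun c => AddMonoidHom.mk'
        (fun c' => tmul B (θ.toHom c) (tmul A (RightRestrict.one β) c'))
        (fun x y => by rw [tmul_add, tmul_add]))
      (fun x y => by ext; simp [add_tmul]))
    (by
      intro x a y
      change tmul B (θ.toHom (op a • x)) (tmul A (RightRestrict.one β) y) =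
        tmul B (θ.toHom x) (tmul A (RightRestrict.one β) (a • y))
      rw [θ.map_op_smul, smul_tmul, left_smul_tmul, ← smul_tmul (RightRestrict.one β),
        RightRestrict.op_smul_one])

theorem leftCoactAux_tmul (c c' : C) : θ.leftCoactAux (tmul A c c') =
    tmul B (θ.toHom c) (tmul A (RightRestrict.one β) c') := by
  rw [leftCoactAux, lift_tmul]; rfl

theorem leftCoactAux_smul (a : A) (z : TensorOver A C C) :
    θ.leftCoactAux (a • z) = β a • θ.leftCoactAux z := by
  induction z using TensorOver.induction_on with
  | zero => simp only [map_zero, smul_zero]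
  | tmul c c' =>
    rw [left_smul_tmul, leftCoactAux_tmul, leftCoactAux_tmul, θ.map_smul, left_smul_tmul]
  | add x y hx hy => simp only [smul_add, map_add, hx, hy]

/-- The left `D`-coaction `b ⊗ c ↦ ∑ b θ(c₁) ⊗ (1 ⊗ c₂)` of `B ⊗_A C`. -/
def leftCoact : BaseTensor β C →+ TensorOver B D (BaseTensor β C) :=
  lift (AddMonoidHom.mk' (fun b => AddMonoidHom.mk'
        (fun c => (show B from b) • θ.leftCoactAux (Coring.comul (A := A) c))
        (fun x y => by rw [map_add, map_add, smul_add]))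
      (fun b b' => by
        ext c
        exact add_smul (show B from b) (show B from b') _))
    (by
      intro b a c
      change ((show B from b) * β a) • θ.leftCoactAux (Coring.comul (A := A) c) =
        (show B from b) • θ.leftCoactAux (Coring.comul (A := A) (a • c))
      rw [LinearMap.map_smul, leftCoactAux_smul, mul_smul])

theorem leftCoact_tmul (b : RightRestrict β) (c : C) : θ.leftCoact (tmul A b c) =
    (show B from b) • θ.leftCoactAux (Coring.comul (A := A) c) := by
  rw [leftCoact, lift_tmul]; rfl

theorem leftCoact_smul (b : B) (x : BaseTensor β C) :
    θ.leftCoact (b • x) = b • θ.leftCoact x := by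
  induction x using TensorOver.induction_on with
  | zero => simp only [map_zero, smul_zero]
  | tmul b' c => rw [left_smul_tmul, leftCoact_tmul, leftCoact_tmul, ← mul_smul]; rfl
  | add x y hx hy => simp only [smul_add, map_add, hx, hy]

theorem leftCoact_act (f : LeftDual A C) (x : BaseTensor β C) :
    θ.leftCoact (op f • x) = op f • θ.leftCoact x := by
  induction x using TensorOver.induction_on with
  | zero => simp only [map_zero, smul_zero]
  | tmul b c =>
    rw [right_smul_tmul, leftCoact_tmul, leftCoact_tmul, ← smul_comm (show B from b) (op f),
      op_smul_eq_act,
      comul_act]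
    congr 1
    generalize Coring.comul (A := A) c = z
    induction z using TensorOver.induction_on with
    | zero => simp only [map_zero, smul_zero]
    | tmul m n =>
      rw [map_tmul, leftCoactAux_tmul, leftCoactAux_tmul, right_smul_tmul, right_smul_tmul]
      rfl
    | add x y hx hy => simp only [smul_add, map_add, hx, hy]
  | add x y hx hy => simp only [smul_add, map_add, hx, hy]

variable (β C) in
/-- The right `C`-coaction `b ⊗ c ↦ ∑ (b ⊗ c₁) ⊗ c₂` of `B ⊗_A C`. -/
def rightCoact : BaseTensor β C →+ TensorOver A (BaseTensor β C) C :=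
  tensorCoact (RightRestrict β) (Coring.comul (A := A) (C := C)).toAddMonoidHom
    (toAdd_smul Coring.comul)

theorem rightCoact_smul (b : B) (x : BaseTensor β C) :
    rightCoact β C (b • x) = b • rightCoact β C x :=
  tensorCoact_smul _ _ b x

variable (β C) in
/-- The map `n ⊗ (b ⊗ c) ↦ ∑ (n ⊗ (b ⊗ c₁)) ⊗ c₂` on `N ⊗_B (B ⊗_A C)`. -/
def bigCoact (N : Type u) [AddCommGroup N] [Module Bᵐᵒᵖ N] :
    TensorOver B N (BaseTensor β C) →+ TensorOver A (TensorOver B N (BaseTensor β C)) C :=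
  tensorCoact N (rightCoact β C) rightCoact_smul

/-- The right action of an element of the left dual of `C` as an additive map. -/
def opHom (X : Type*) [AddCommGroup X] [Module (LeftDual A C)ᵐᵒᵖ X] (f : LeftDual A C) :
    X →+ X := DistribSMul.toAddMonoidHom X (op f)

theorem contract_rightCoact (f : LeftDual A C) (x : BaseTensor β C) :
    contract f.toLin (rightCoact β C x) = op f • x :=
  contract_tensorCoact _ _ f.toLin (act f).toAddMonoidHom (toAdd_smul (act f)) (fun _ => rfl) x

theorem contract_bigCoact (N : Type u) [AddCommGroup N] [Module Bᵐᵒᵖ N] (f : LeftDual A C)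
    (x : TensorOver B N (BaseTensor β C)) :
    contract f.toLin (bigCoact β C N x) = op f • x :=
  contract_tensorCoact _ _ f.toLin (opHom (BaseTensor β C) f)
    (fun b x => (smul_comm b (op f) x).symm) (contract_rightCoact f) x

theorem ofBase_smul_tensor (a : A) (x : BaseTensor β C) :
    op a • x = op (LeftDual.ofBase A C a) • x := by
  induction x using TensorOver.induction_on with
  | zero => simp only [smul_zero]
  | tmul b c => rw [right_smul_tmul, right_smul_tmul, op_smul_eq_act]
                exact congrArg _ (act_ofBaseFun a c).symm
  | add x y hx hy => simp only [smul_add, hx, hy]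

theorem ofBase_smul_big (N : Type u) [AddCommGroup N] [Module Bᵐᵒᵖ N] (a : A)
    (x : TensorOver B N (BaseTensor β C)) :
    op a • x = op (LeftDual.ofBase A C a) • x := by
  induction x using TensorOver.induction_on with
  | zero => simp only [smul_zero]
  | tmul n x => rw [right_smul_tmul, right_smul_tmul, ofBase_smul_tensor]
  | add x y hx hy => simp only [smul_add, hx, hy]

/-- The cotensor product `N □_D (B ⊗_A C)`. -/
def adCotensor (N : Comod B D) : AddSubgroup (TensorOver B N (BaseTensor β C)) :=
  cotensor N.coact.toAddMonoidHom (toAdd_op_smul N.coact fun b => N.coact.map_smul (op b))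
    θ.leftCoact θ.leftCoact_smul

theorem mem_adCotensor (N : Comod B D) (x : TensorOver B N (BaseTensor β C)) :
    x ∈ θ.adCotensor N ↔
      assoc (map N.coact.toAddMonoidHom (AddMonoidHom.id (BaseTensor β C))
        (toAdd_op_smul N.coact fun b => N.coact.map_smul (op b)) idHom_smul x) =
      map (AddMonoidHom.id N) θ.leftCoact idHom_op_smul θ.leftCoact_smul x := by
  rw [adCotensor, cotensor, AddMonoidHom.mem_ker, AddMonoidHom.sub_apply, sub_eq_zero]
  rfl

theorem act_mem_adCotensor (N : Comod B D) (f : LeftDual A C)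
    {x : TensorOver B N (BaseTensor β C)} (hx : x ∈ θ.adCotensor N) :
    op f • x ∈ θ.adCotensor N := by
  rw [mem_adCotensor] at hx ⊢
  have h1 : ∀ x : TensorOver B N (BaseTensor β C),
      assoc (map N.coact.toAddMonoidHom (AddMonoidHom.id (BaseTensor β C))
        (toAdd_op_smul N.coact fun b => N.coact.map_smul (op b)) idHom_smul (op f • x)) =
      op f • assoc (map N.coact.toAddMonoidHom (AddMonoidHom.id (BaseTensor β C))
        (toAdd_op_smul N.coact fun b => N.coact.map_smul (op b)) idHom_smul x) := by
    intro x
    induction x using TensorOver.induction_on with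
    | zero => simp only [map_zero, smul_zero]
    | tmul n p =>
      rw [right_smul_tmul, map_tmul, map_tmul]
      generalize N.coact.toAddMonoidHom n = z
      induction z using TensorOver.induction_on with
      | zero => simp only [zero_tmul, map_zero, smul_zero]
      | tmul m d =>
        rw [assoc_tmul, assoc_tmul, right_smul_tmul, right_smul_tmul]; rfl
      | add x y hx hy => simp only [add_tmul, map_add, smul_add, hx, hy]
    | add x y hx hy => simp only [map_add, smul_add, hx, hy]
  have h2 : ∀ x : TensorOver B N (BaseTensor β C),
      map (AddMonoidHom.id N) θ.leftCoact idHom_op_smul θ.leftCoact_smul (op f • x) =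
      op f • map (AddMonoidHom.id N) θ.leftCoact idHom_op_smul θ.leftCoact_smul x := by
    intro x
    induction x using TensorOver.induction_on with
    | zero => simp only [map_zero, smul_zero]
    | tmul n p => rw [right_smul_tmul, map_tmul, map_tmul, leftCoact_act, right_smul_tmul]
    | add x y hx hy => simp only [map_add, smul_add, hx, hy]
  rw [h1, h2, hx]

/-- `N □_D (B ⊗_A C)` as a right `A`-submodule of `N ⊗_B (B ⊗_A C)`. -/
def adSub (N : Comod B D) : Submodule Aᵐᵒᵖ (TensorOver B N (BaseTensor β C)) where
  carrier := θ.adCotensor N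
  add_mem' := (θ.adCotensor N).add_mem
  zero_mem' := (θ.adCotensor N).zero_mem
  smul_mem' := by
    intro a x hx
    obtain ⟨a, rfl⟩ := op_surjective a
    rw [ofBase_smul_big]
    exact θ.act_mem_adCotensor N _ hx

/-- The right action of the left dual of `C` on `N □_D (B ⊗_A C)`. -/
instance adSubModule (N : Comod B D) : Module (LeftDual A C)ᵐᵒᵖ (θ.adSub N) where
  smul f x := ⟨f • x.1, θ.act_mem_adCotensor N (unop f) x.2⟩
  one_smul x := Subtype.ext (one_smul _ x.1)
  mul_smul f g x := Subtype.ext (mul_smul f g x.1)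
  smul_zero f := Subtype.ext (smul_zero f)
  smul_add f x y := Subtype.ext (smul_add f x.1 y.1)
  add_smul f g x := Subtype.ext (add_smul f g x.1)
  zero_smul x := Subtype.ext (zero_smul _ x.1)

theorem existsUnique_adCoact (hC : LocallyProjective A C) (N : Comod B D) (x : θ.adSub N) :
    ∃! w : TensorOver A (θ.adSub N) C,
      map (θ.adSub N).subtype.toAddMonoidHom (AddMonoidHom.id C)
        (toAdd_op_smul _ fun _ _ => rfl) idHom_smul w = bigCoact β C N x := by
  obtain ⟨w, hw⟩ := hC.exists_lift (θ.adSub N).subtype.toAddMonoidHom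
    (toAdd_op_smul _ fun _ _ => rfl) (bigCoact β C N x)
    (fun f => ⟨op f • x, (contract_bigCoact N f x.1).symm⟩)
  refine ⟨w, hw, fun w' hw' => hC.ext fun f => Subtype.ext ?_⟩
  have h := congrArg (contract f.toLin) (hw'.trans hw.symm)
  rw [contract_map _ _ _ _ f.toLin f.toLin (fun _ => rfl),
    contract_map _ _ _ _ f.toLin f.toLin (fun _ => rfl)] at h
  exact h

/-- The coaction `∑ nᵢ ⊗ (bᵢ ⊗ cᵢ) ↦ ∑ (nᵢ ⊗ (bᵢ ⊗ cᵢ₁)) ⊗ cᵢ₂` of `N □_D (B ⊗_A C)`: the unique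
lift of the right-hand side to `(N □_D (B ⊗_A C)) ⊗_A C`. -/
noncomputable def adCoact (hC : LocallyProjective A C) (N : Comod B D) (x : θ.adSub N) :
    TensorOver A (θ.adSub N) C :=
  (θ.existsUnique_adCoact hC N x).choose

theorem map_adCoact (hC : LocallyProjective A C) (N : Comod B D) (x : θ.adSub N) :
    map (θ.adSub N).subtype.toAddMonoidHom (AddMonoidHom.id C)
      (toAdd_op_smul _ fun _ _ => rfl) idHom_smul (θ.adCoact hC N x) = bigCoact β C N x :=
  (θ.existsUnique_adCoact hC N x).choose_spec.1

theorem contract_adCoact (hC : LocallyProjective A C) (N : Comod B D) (f : LeftDual A C)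
    (x : θ.adSub N) : contract f.toLin (θ.adCoact hC N x) = op f • x := by
  refine Subtype.ext (Eq.trans ?_ (contract_bigCoact N f x.1))
  rw [← map_adCoact, contract_map _ _ _ _ f.toLin f.toLin (fun _ => rfl)]
  rfl

/-- The right `C`-comodule `N □_D (B ⊗_A C)`. -/
noncomputable def adComod (hC : LocallyProjective A C) (N : Comod B D) : Comod A C :=
  Comod.ofRational hC (θ.adSub N) (fun a x => Subtype.ext (ofBase_smul_big N a x.1))
    (θ.adCoact hC N) (θ.contract_adCoact hC N)

/-- The map `u ⊗ id` on `N ⊗_B (B ⊗_A C)`. -/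
def bigMap {N N' : Comod B D} (u : N ⟶ N') :
    TensorOver B N (BaseTensor β C) →+ TensorOver B N' (BaseTensor β C) :=
  map (Comod.Hom.toLin u).toAddMonoidHom (AddMonoidHom.id _)
    (toAdd_op_smul _ fun b => (Comod.Hom.toLin u).map_smul (op b)) idHom_smul

theorem bigMap_tmul {N N' : Comod B D} (u : N ⟶ N') (n : N) (p : BaseTensor β C) :
    bigMap u (tmul B n p) = tmul B (Comod.Hom.toLin u n) p := map_tmul _ _ _ _ _ _

theorem bigMap_act {N N' : Comod B D} (u : N ⟶ N') (f : LeftDual A C)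
    (x : TensorOver B N (BaseTensor β C)) : bigMap u (op f • x) = op f • bigMap u x := by
  induction x using TensorOver.induction_on with
  | zero => simp only [map_zero, smul_zero]
  | tmul n p => rw [right_smul_tmul, bigMap_tmul, bigMap_tmul, right_smul_tmul]
  | add x y hx hy => simp only [map_add, smul_add, hx, hy]

theorem bigMap_mem {N N' : Comod B D} (u : N ⟶ N') {x : TensorOver B N (BaseTensor β C)}
    (hx : x ∈ θ.adCotensor N) : bigMap u x ∈ θ.adCotensor N' := by
  rw [mem_adCotensor] at hx ⊢
  have h1 : ∀ x : TensorOver B N (BaseTensor β C),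
      assoc (map N'.coact.toAddMonoidHom (AddMonoidHom.id (BaseTensor β C))
        (toAdd_op_smul N'.coact fun b => N'.coact.map_smul (op b)) idHom_smul (bigMap u x)) =
      map (Comod.Hom.toLin u).toAddMonoidHom (AddMonoidHom.id _)
        (toAdd_op_smul _ fun b => (Comod.Hom.toLin u).map_smul (op b)) idHom_smul
        (assoc (map N.coact.toAddMonoidHom (AddMonoidHom.id (BaseTensor β C))
          (toAdd_op_smul N.coact fun b => N.coact.map_smul (op b)) idHom_smul x)) := by
    intro x
    induction x using TensorOver.induction_on with
    | zero => simp only [map_zero]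
    | tmul n p =>
      rw [bigMap_tmul, map_tmul, map_tmul]
      change assoc (tmul B (N'.coact (Comod.Hom.toLin u n)) p) =
        map _ _ _ _ (assoc (tmul B (N.coact n) p))
      rw [Comod.Hom.colinear u n]
      generalize N.coact n = z
      induction z using TensorOver.induction_on with
      | zero => simp only [zero_tmul, map_zero]
      | tmul m d => rw [map_tmul, assoc_tmul, assoc_tmul, map_tmul]; rfl
      | add x y hx hy => simp only [add_tmul, map_add, hx, hy]
    | add x y hx hy => simp only [map_add, hx, hy]
  have h2 : ∀ x : TensorOver B N (BaseTensor β C),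
      map (AddMonoidHom.id N') θ.leftCoact idHom_op_smul θ.leftCoact_smul (bigMap u x) =
      map (Comod.Hom.toLin u).toAddMonoidHom (AddMonoidHom.id _)
        (toAdd_op_smul _ fun b => (Comod.Hom.toLin u).map_smul (op b)) idHom_smul
        (map (AddMonoidHom.id N) θ.leftCoact idHom_op_smul θ.leftCoact_smul x) := by
    intro x
    induction x using TensorOver.induction_on with
    | zero => simp only [map_zero]
    | tmul n p => rw [bigMap_tmul, map_tmul, map_tmul, map_tmul]; rfl
    | add x y hx hy => simp only [map_add, hx, hy]
  rw [h1, h2, hx]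

/-- The map `u □ id` on `N □_D (B ⊗_A C)`. -/
def adMap {N N' : Comod B D} (u : N ⟶ N') : θ.adSub N →ₗ[Aᵐᵒᵖ] θ.adSub N' where
  toFun x := ⟨bigMap u x.1, θ.bigMap_mem u x.2⟩
  map_add' x y := Subtype.ext (map_add (bigMap u) x.1 y.1)
  map_smul' a x := Subtype.ext (by
    obtain ⟨a, rfl⟩ := op_surjective a
    change bigMap u (op a • x.1) = op a • bigMap u x.1
    rw [ofBase_smul_big, bigMap_act, ← ofBase_smul_big])

/-- The ad-induction functor `N ↦ N □_D (B ⊗_A C)` from right `D`-comodules to right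
`C`-comodules, for `C` locally projective as a left `A`-module. -/
noncomputable def adInduction (hC : LocallyProjective A C) : Comod B D ⥤ Comod A C where
  obj N := θ.adComod hC N
  map {N N'} u := ⟨θ.adMap u, colinear_of_act hC (θ.adComod hC N) (θ.adComod hC N') (θ.adMap u)
    fun f x => (congrArg (θ.adMap u) (θ.contract_adCoact hC N f x)).trans
      ((Subtype.ext (bigMap_act u f x.1)).trans
        (θ.contract_adCoact hC N' f (θ.adMap u x)).symm)⟩
  map_id N := Comod.hom_ext fun x => Subtype.ext (by
    change bigMap (𝟙 N) x.1 = x.1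
    generalize x.1 = y
    induction y using TensorOver.induction_on with
    | zero => rw [map_zero]
    | tmul n p => rw [bigMap_tmul]; rfl
    | add x y hx hy => rw [map_add, hx, hy])
  map_comp u v := Comod.hom_ext fun x => Subtype.ext (by
    change bigMap (u ≫ v) x.1 = bigMap v (bigMap u x.1)
    generalize x.1 = y
    induction y using TensorOver.induction_on with
    | zero => simp only [map_zero]
    | tmul n p => rw [bigMap_tmul, bigMap_tmul, bigMap_tmul]; rfl
    | add x y hx hy => simp only [map_add, hx, hy])

end CoringHom

end Cotensor

end Corings

namespace Corings

open TensorOver CoringHom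

/-! The isomorphism is evaluation. A left `A`-linear `h : C → B` extends to the left `B`-linear
functional `b ⊗ c ↦ b h(c)` on `B ⊗_A C`, and contracting the second factor of `x ∈ N ⊗_B (B ⊗_A C)`
with it gives an element `x(h)` of `N`. Under this pairing both dual actions on `Hom_{A-}(C, B)` are
transposes: the left action of `*C` corresponds to its right action on `C` (`contract_extend_smul`),
and the right action of `*D` to the left `D`-coaction on `B ⊗_A C` (`contract_extend_leftCoact`).

Two separation statements carry the argument. Since `M ⊗_B (B ⊗_A C)` is essentially `M ⊗_A C`,
local projectivity of `C` says that its elements are determined by their values on the functionals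
`β ∘ f` (`ext_contract_extend`); local projectivity of `D` gives the same for `N ⊗_B D`. Together
they show that `x` lies in the cotensor product exactly when `h ↦ x(h)` is right `*D`-linear on
`_#C`: `contract_extend_of_mem` and `mem_adCotensor_of_contract` are the two directions.
Compatibility is what makes `_#C` stable under `*D`, so that this linearity makes sense.

Evaluation is therefore a `*C`-linear injection of the cotensor product into `Hom(_#C, N)`, and its
image is rational because its source is a `C`-comodule. Conversely, let `φ` be rational with witness
`∑ ψᵢ ⊗ cᵢ`. Since `f ⇀ (β ∘ ε) = β ∘ f`, one has `φ(β ∘ f) = (φ f)(β ∘ ε) = ∑ ψᵢ(β ∘ ε) β(f(cᵢ))`.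
So `φ` is evaluation of `∑ ψᵢ(β ∘ ε) ⊗ (1 ⊗ cᵢ)`, and the `*D`-linearity of `φ` puts this element in
the cotensor product (`exists_evalHom_eq`). -/

/-! ### Generalities on tensor products and comodules -/

/-- Lets an equation in `N ⊗ (D ⊗ (B ⊗ C))` be checked in `(N ⊗ D) ⊗ (B ⊗ C)`, where the last factor
can be contracted and separation applies. -/
theorem TensorOver.assoc_surjective {A B M N P : Type*} [Ring A] [Ring B] [AddCommGroup M]
    [AddCommGroup N] [AddCommGroup P] [Module Aᵐᵒᵖ M] [Module A N] [Module Bᵐᵒᵖ N]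
    [SMulCommClass A Bᵐᵒᵖ N] [Module B P] :
    Function.Surjective
      (assoc : TensorOver B (TensorOver A M N) P →+ TensorOver A M (TensorOver B N P)) := by
  intro z
  induction z using TensorOver.induction_on with
  | zero => exact ⟨0, map_zero _⟩
  | tmul m y =>
    induction y using TensorOver.induction_on with
    | zero => exact ⟨0, by rw [map_zero, tmul_zero]⟩
    | tmul n p => exact ⟨tmul B (tmul A m n) p, assoc_tmul m n p⟩
    | add x y hx hy =>
      obtain ⟨x', hx⟩ := hx
      obtain ⟨y', hy⟩ := hy
      exact ⟨x' + y', by rw [map_add, hx, hy, tmul_add]⟩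
  | add x y hx hy =>
    obtain ⟨x', hx⟩ := hx
    obtain ⟨y', hy⟩ := hy
    exact ⟨x' + y', by rw [map_add, hx, hy]⟩

/-- Scalars of the base ring act on a comodule through the left dual. -/
theorem Comod.op_ofBase_smul {A C : Type u} [Ring A] [AddCommGroup C] [Module A C]
    [Module Aᵐᵒᵖ C] [SMulCommClass A Aᵐᵒᵖ C] [Coring A C] (M : Comod A C) (a : A) (m : M) :
    M.actHom (LeftDual.ofBase A C a) m = op a • m := by
  -- The unit of the left dual is the counit, so this choice of functional lets counitality of `M`
  -- finish the computation.
  have h := contract_ofBaseFun (M := M) a (1 : LeftDual A C) (M.coact m)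
  rw [mul_one] at h
  refine h.trans ?_
  rw [← M.coact.map_smul (op a) m]
  exact M.counit _

/-- If `C` is locally projective, bijective colinear maps are isomorphisms. -/
theorem Comod.isIso_of_bijective {A C : Type u} [Ring A] [AddCommGroup C] [Module A C]
    [Module Aᵐᵒᵖ C] [SMulCommClass A Aᵐᵒᵖ C] [Coring A C] (hC : LocallyProjective A C)
    {M N : Comod A C} (u : M ⟶ N) (hu : Function.Bijective (Comod.Hom.toLin u)) :
    CategoryTheory.IsIso u := by
  let e := LinearEquiv.ofBijective (Comod.Hom.toLin u) hu
  have he : ∀ m, Comod.Hom.toLin u (e.symm m) = m := e.apply_symm_apply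
  -- Over a locally projective coring, colinearity follows from commuting with the left dual. For
  -- the inverse this is checked after applying the injective map `u`, which already commutes.
  refine ⟨⟨⟨e.symm.toLinearMap, colinear_of_act hC N M e.symm.toLinearMap fun f m => hu.1 ?_⟩,
    Comod.hom_ext fun m => e.symm_apply_apply m, Comod.hom_ext he⟩⟩
  have h := Comod.Hom.actHom u f (e.symm m)
  rw [he] at h
  exact (he _).trans h.symm

section

variable {A B : Type u} [Ring A] [Ring B] {β : A →+* B}
  {C D : Type u} [AddCommGroup C] [Module A C] [Module Aᵐᵒᵖ C] [SMulCommClass A Aᵐᵒᵖ C]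
  [Coring A C] [AddCommGroup D] [Module B D] [Module Bᵐᵒᵖ D] [SMulCommClass B Bᵐᵒᵖ D]
  [Coring B D] {θ : CoringHom β C D}

/-! ### Functionals on `B ⊗_A C` extended from `C` -/

namespace SharpDual

/-- The left `B`-linear functional `b ⊗ c ↦ b h(c)` on `B ⊗_A C`. -/
def extend (h : SharpDual θ) : BaseTensor β C →ₗ[B] B where
  toFun := lift (AddMonoidHom.mk' (fun b : RightRestrict β => AddMonoidHom.mk'
        (fun c => (show B from b) * h.toLin c) (fun x y => by rw [map_add, mul_add]))
      (fun b b' => by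
        ext c
        exact add_mul (show B from b) (show B from b') _))
    (by
      intro b a c
      change ((show B from b) * β a) * h.toLin c = (show B from b) * h.toLin (a • c)
      rw [LinearMap.map_smulₛₗ, smul_eq_mul, mul_assoc])
  map_add' := map_add _
  map_smul' b x := by
    induction x using TensorOver.induction_on with
    | zero => simp only [map_zero, smul_zero]
    | tmul b' c =>
      rw [left_smul_tmul, lift_tmul, lift_tmul]
      exact mul_assoc b _ _
    | add x y hx hy => simp only [smul_add, map_add, hx, hy]

theorem extend_tmul (h : SharpDual θ) (b : RightRestrict β) (c : C) :
    h.extend (tmul A b c) = (show B from b) * h.toLin c := lift_tmul _ _ _ _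

theorem extend_one_tmul (h : SharpDual θ) (c : C) :
    h.extend (tmul A (RightRestrict.one β) c) = h.toLin c :=
  (h.extend_tmul _ c).trans (one_mul _)

theorem extend_add (h h' : SharpDual θ) : (h + h').extend = h.extend + h'.extend := by
  ext x
  induction x using TensorOver.induction_on with
  | zero => simp only [map_zero]
  | tmul b c =>
    rw [LinearMap.add_apply, extend_tmul, extend_tmul, extend_tmul, add_toLin, mul_add]
  | add x y hx hy => simp only [map_add, hx, hy]

theorem extend_smul (φ : LeftDual A C) (h : SharpDual θ) (x : BaseTensor β C) :
    (φ • h).extend x = h.extend (op φ • x) := by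
  induction x using TensorOver.induction_on with
  | zero => simp only [map_zero, smul_zero]
  | tmul b c => rw [right_smul_tmul, extend_tmul, extend_tmul]; rfl
  | add x y hx hy => simp only [map_add, smul_add, hx, hy]

/-- The right `*D`-action is the transpose of the left `D`-coaction: on `b ⊗ c`, contracting `∑ b
θ(c₁) ⊗ (1 ⊗ c₂)` with the extension of `h` gives `b ∑ θ(c₁) h(c₂)`, and applying `g` gives `b (h ↼
g)(c)`. -/
theorem contract_extend_leftCoact (h : SharpDual θ) (g : LeftDual B D) (x : BaseTensor β C) :
    g.toLin (contract h.extend (θ.leftCoact x)) = (op g • h).extend x := by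
  induction x using TensorOver.induction_on with
  | zero => simp only [map_zero]
  | tmul b c =>
    rw [leftCoact_tmul, contract_left_smul, LinearMap.map_smul, smul_eq_mul, extend_tmul,
      op_smul_toLin, twist_apply]
    -- Removing `b` and `g` leaves an identity in `D` that holds for every element of `C ⊗_A C`, not
    -- only for `Δ(c)`.
    congr 2
    generalize Coring.comul (A := A) c = z
    induction z using TensorOver.induction_on with
    | zero => simp only [map_zero]
    | tmul m n => rw [leftCoactAux_tmul, contract_tmul, extend_one_tmul, twistAux_tmul]
    | add x y hx hy => simp only [map_add, hx, hy]
  | add x y hx hy => simp only [map_add, hx, hy]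

/-- This is what makes the evaluation map `*C`-linear for the action `(ψ φ)(h) = ψ(φ ⇀ h)` on its
target. -/
theorem contract_extend_smul {N : Type u} [AddCommGroup N] [Module Bᵐᵒᵖ N] (φ : LeftDual A C)
    (h : SharpDual θ) (x : TensorOver B N (BaseTensor β C)) :
    contract h.extend (op φ • x) = contract (φ • h).extend x := by
  induction x using TensorOver.induction_on with
  | zero => simp only [map_zero, smul_zero]
  | tmul n p => rw [right_smul_tmul, contract_tmul, contract_tmul, extend_smul]
  | add x y hx hy => simp only [map_add, smul_add, hx, hy]

end SharpDual

/-! ### Separation by `β ∘ f` and the cotensor condition as `*D`-linearity -/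

namespace CoringHom

variable (θ) in
/-- The functionals obtained from `β ∘ f`, for `f` in the left dual of `C`, separate the elements
of `M ⊗_B (B ⊗_A C)`. -/
theorem ext_contract_extend (hC : LocallyProjective A C) {M : Type u} [AddCommGroup M]
    [Module Bᵐᵒᵖ M] {z w : TensorOver B M (BaseTensor β C)}
    (h : ∀ f : LeftDual A C,
      contract (θ.postComp f).extend z = contract (θ.postComp f).extend w) : z = w := by
  -- With `M` restricted along `β`, the map `j : m ⊗ c ↦ m ⊗ (1 ⊗ c)` transports the separation
  -- property of `M ⊗_A C`. Surjectivity of `j` suffices: preimages of `z` and `w` with equal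
  -- contractions already coincide.
  let _ : Module Aᵐᵒᵖ M := Module.compHom M β.op
  let j : TensorOver A M C →+ TensorOver B M (BaseTensor β C) :=
    lift (AddMonoidHom.mk' (fun m => (tmulHom B m).comp (tmulHom A (RightRestrict.one β)))
        (fun m m' => by ext; simp))
      (by
        intro m a c
        change tmul B (op (β a) • m) (tmul A (RightRestrict.one β) c) =
          tmul B m (tmul A (RightRestrict.one β) (a • c))
        rw [smul_tmul, left_smul_tmul, ← smul_tmul (RightRestrict.one β),
          RightRestrict.op_smul_one])
  have hj : ∀ m c, j (tmul A m c) = tmul B m (tmul A (RightRestrict.one β) c) :=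
    fun m c => lift_tmul _ _ _ _
  have hjs : Function.Surjective j := by
    intro z
    induction z using TensorOver.induction_on with
    | zero => exact ⟨0, map_zero _⟩
    | tmul m y =>
      induction y using TensorOver.induction_on with
      | zero => exact ⟨0, by rw [map_zero, tmul_zero]⟩
      | tmul b c =>
        -- Moving `b` back across the tensor sign turns `m b ⊗ (1 ⊗ c)` into `m ⊗ (b ⊗ c)`.
        refine ⟨tmul A (op (show B from b) • m) c, ?_⟩
        rw [hj, smul_tmul, left_smul_tmul]
        exact congrArg (fun b : RightRestrict β => tmul B m (tmul A b c)) (mul_one (show B from b))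
      | add x y hx hy =>
        obtain ⟨x', hx⟩ := hx
        obtain ⟨y', hy⟩ := hy
        exact ⟨x' + y', by rw [map_add, hx, hy, tmul_add]⟩
    | add x y hx hy =>
      obtain ⟨x', hx⟩ := hx
      obtain ⟨y', hy⟩ := hy
      exact ⟨x' + y', by rw [map_add, hx, hy]⟩
  have hjc : ∀ (f : LeftDual A C) z,
      contract (θ.postComp f).extend (j z) = contract f.toLin z := by
    intro f z
    induction z using TensorOver.induction_on with
    | zero => simp only [map_zero]
    | tmul m c =>
      rw [hj, contract_tmul, SharpDual.extend_one_tmul, contract_tmul]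
      rfl
    | add x y hx hy => simp only [map_add, hx, hy]
  obtain ⟨z, rfl⟩ := hjs z
  obtain ⟨w, rfl⟩ := hjs w
  refine congrArg j (hC.ext fun f => ?_)
  rw [← hjc, ← hjc, h]

/-- Evaluation by the extension of `h` turns the coaction on the left factor of
`N ⊗_B (B ⊗_A C)` into the coaction of `N`. -/
theorem contract_coact_extend (N : Comod B D) (h : SharpDual θ)
    (x : TensorOver B N (BaseTensor β C)) :
    contract h.extend (map N.coact.toAddMonoidHom (AddMonoidHom.id (BaseTensor β C))
      (toAdd_op_smul N.coact fun b => N.coact.map_smul (op b)) idHom_smul x) =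
    N.coact (contract h.extend x) :=
  contract_map _ _ _ _ h.extend h.extend (fun _ => rfl) x

/-- The transpose relation of `contract_extend_leftCoact`, tensored with `N`: it evaluates the side
of the cotensor equation that involves the coaction of `B ⊗_A C`. -/
theorem contract_leftCoact_extend (N : Comod B D) (h : SharpDual θ) (g : LeftDual B D)
    (x : TensorOver B N (BaseTensor β C)) :
    contract g.toLin (map (AddMonoidHom.id N)
      (contract h.extend : TensorOver B D (BaseTensor β C) →+ D) idHom_op_smul
      (fun b z => contract_left_smul h.extend b z)
      (map (AddMonoidHom.id N) θ.leftCoact idHom_op_smul θ.leftCoact_smul x)) =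
    contract (op g • h).extend x := by
  induction x using TensorOver.induction_on with
  | zero => simp only [map_zero]
  | tmul n p =>
    rw [map_tmul, map_tmul, contract_tmul, contract_tmul, SharpDual.contract_extend_leftCoact]
    rfl
  | add x y hx hy => simp only [map_add, hx, hy]

/-- Contract the cotensor equation with the extension of `h` and then with `g`: the coaction of `N`
produces the action of `g` on `x(h)`, the coaction of `B ⊗_A C` produces `x(h ↼ g)`. No local
projectivity is needed in this direction. -/
theorem contract_extend_of_mem (N : Comod B D) {x : TensorOver B N (BaseTensor β C)}
    (hx : x ∈ θ.adCotensor N) (h : SharpDual θ) (g : LeftDual B D) :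
    contract (op g • h).extend x = N.actHom g (contract h.extend x) := by
  rw [mem_adCotensor] at hx
  rw [← contract_leftCoact_extend, ← hx, ← contract_assoc, contract_coact_extend]
  rfl

/-- Both sides of the cotensor equation can be tested on pairs `(f, g)`: the functionals `β ∘ f`
separate in the factor `B ⊗_A C`, and then `g` separates in `N ⊗_B D`. For each pair the equation is
the assumed linearity. -/
theorem mem_adCotensor_of_contract (hC : LocallyProjective A C) (hD : LocallyProjective B D)
    (N : Comod B D) {x : TensorOver B N (BaseTensor β C)}
    (h : ∀ (f : LeftDual A C) (g : LeftDual B D),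
      contract (op g • θ.postComp f).extend x =
        N.actHom g (contract (θ.postComp f).extend x)) : x ∈ θ.adCotensor N := by
  rw [mem_adCotensor]
  -- The side coming from `leftCoact` is bracketed the wrong way for contraction, so it is replaced
  -- by a preimage under associativity.
  obtain ⟨y, hy⟩ := assoc_surjective
    (map (AddMonoidHom.id N) θ.leftCoact idHom_op_smul θ.leftCoact_smul x)
  rw [← hy]
  refine congrArg _ (θ.ext_contract_extend hC fun f => hD.ext fun g => ?_)
  rw [contract_coact_extend, contract_assoc _ y, hy, contract_leftCoact_extend, h]
  rfl

/-! ### The evaluation map, its injectivity and its rational image -/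

variable (hθ : θ.Compatible)

/-- The map `N □_D (B ⊗_A C) → Hom(_#C, N)`, `∑ n ⊗ (b ⊗ c) ↦ (h ↦ ∑ n b h(c))`. -/
def evalHom (N : Comod B D) : θ.adSub N →ₗ[(LeftDual A C)ᵐᵒᵖ] SharpHom hθ N.AsModule where
  toFun x :=
    { toFun := fun h => contract (M := N) h.1.extend x.1
      map_add' := fun h h' => (congrArg (fun e => contract (M := N) e x.1)
        (SharpDual.extend_add h.1 h'.1)).trans (contract_add_left (M := N) _ _ x.1)
      -- Here membership in the cotensor product is used: it is what makes evaluation at `x` linear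
      -- over `*D`.
      map_smul' := fun g h => contract_extend_of_mem N x.2 h.1 (unop g) }
  map_add' x y := SharpHom.ext fun h => map_add (contract (M := N) h.1.extend) x.1 y.1
  map_smul' φ x := SharpHom.ext fun h => SharpDual.contract_extend_smul (N := N) (unop φ) h.1 x.1

theorem evalHom_toLin (N : Comod B D) (x : θ.adSub N) (h : sharpCSub hθ) :
    (evalHom hθ N x).toLin h = contract (M := N) h.1.extend x.1 := rfl

theorem evalHom_injective (hC : LocallyProjective A C) (N : Comod B D) :
    Function.Injective (evalHom hθ N) := fun _ _ hxy =>
  Subtype.ext (θ.ext_contract_extend hC fun f =>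
    congrArg (fun φ : SharpHom hθ N.AsModule => φ.toLin ⟨θ.postComp f, f, rfl⟩) hxy)

/-- A `*C`-linear map carries rational elements to rational elements; the witness is the image of
the coaction of `x`. -/
theorem evalHom_mem_rat (hC : LocallyProjective A C) (N : Comod B D) (x : θ.adSub N) :
    (evalHom hθ N x : RestrictBase A C (SharpHom hθ N.AsModule)) ∈
      rat A C (SharpHom hθ N.AsModule) := by
  let u : θ.adSub N →+ RestrictBase A C (SharpHom hθ N.AsModule) :=
    (evalHom hθ N).toAddMonoidHom
  have hu : ∀ (a : A) y, u (op a • y) = op a • u y := fun a y =>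
    (congrArg (evalHom hθ N) (Subtype.ext (ofBase_smul_big N a y.1))).trans
      ((evalHom hθ N).map_smul (op (LeftDual.ofBase A C a)) y)
  refine ⟨map u (AddMonoidHom.id C) hu idHom_smul (θ.adCoact hC N x), fun f => ?_⟩
  rw [contract_map _ _ _ _ f.toLin f.toLin (fun _ => rfl), contract_adCoact]
  exact ((evalHom hθ N).map_smul (op f) x).symm

/-! ### Recovering a tensor from a rational homomorphism -/

/-- The element `β ∘ f` of the image of `β ∘ -`. -/
def toSharp (f : LeftDual A C) : sharpCSub hθ := ⟨θ.postComp f, f, rfl⟩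

/-- Since `ε_D(∑ θ(c₁) h(c₂)) = h(c)`, the functional `ε_D(-) b` acts on `h` by right multiplication
of its values by `b`. This converts the `A`-action through `*C` into the `B`-action through `*D`. -/
theorem toSharp_ofBase (a : A) :
    toSharp hθ (LeftDual.ofBase A C a) = op (LeftDual.ofBase B D (β a)) • toSharp hθ 1 := by
  refine Subtype.ext (SharpDual.ext fun c => ?_)
  change β (Coring.counit (A := A) c * a) =
    Coring.counit (A := B) ((θ.postComp 1).twist c) * β a
  rw [SharpDual.counit_twist, map_mul]
  rfl

/-- Evaluation at `β ∘ ε`. -/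
def evalOne (N : Comod B D) : RestrictBase A C (SharpHom hθ N.AsModule) →+ N where
  toFun ψ := SharpHom.toLin ψ (toSharp hθ 1)
  map_zero' := rfl
  map_add' _ _ := rfl

/-- The semilinearity that makes `evalCounit` balanced over `A`. -/
theorem evalOne_op_smul (N : Comod B D) (a : A)
    (ψ : RestrictBase A C (SharpHom hθ N.AsModule)) :
    evalOne hθ N (op a • ψ) = op (β a) • evalOne hθ N ψ := by
  -- The left action on `_#C` is multiplication in `*C`: `φ ⇀ (β ∘ f) = β ∘ (φ ⋆ f)`, taken at `f =
  -- ε`.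
  change SharpHom.toLin ψ (toSharp hθ (LeftDual.ofBase A C a * 1)) = _
  rw [mul_one, toSharp_ofBase, LinearMap.map_smul]
  exact N.op_ofBase_smul (β a) _

/-- The map `Hom(_#C, N) ⊗_A C → N ⊗_B (B ⊗_A C)`, `ψ ⊗ c ↦ ψ(β ∘ ε) ⊗ (1 ⊗ c)`. -/
def evalCounit (N : Comod B D) :
    TensorOver A (RestrictBase A C (SharpHom hθ N.AsModule)) C →+
      TensorOver B N (BaseTensor β C) :=
  lift (AddMonoidHom.mk' (fun ψ => (tmulHom B (evalOne hθ N ψ)).comp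
        (tmulHom A (RightRestrict.one β)))
      (fun ψ ψ' => by rw [map_add, map_add]; rfl))
    (by
      intro ψ a c
      change tmul B (evalOne hθ N (op a • ψ)) (tmul A (RightRestrict.one β) c) =
        tmul B (evalOne hθ N ψ) (tmul A (RightRestrict.one β) (a • c))
      rw [evalOne_op_smul, smul_tmul, left_smul_tmul, ← smul_tmul (RightRestrict.one β),
        RightRestrict.op_smul_one])

theorem evalCounit_tmul (N : Comod B D) (ψ : RestrictBase A C (SharpHom hθ N.AsModule)) (c : C) :
    evalCounit hθ N (tmul A ψ c) = tmul B (evalOne hθ N ψ) (tmul A (RightRestrict.one β) c) :=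
  lift_tmul _ _ _ _

/-- On `ψ ⊗ c` both sides are `ψ(β ∘ ε) β(f(c))`, by semilinearity of `evalOne`. For a witness of
rationality of `φ`, the right side becomes `(φ f)(β ∘ ε)`. -/
theorem contract_evalCounit (N : Comod B D) (f : LeftDual A C)
    (z : TensorOver A (RestrictBase A C (SharpHom hθ N.AsModule)) C) :
    contract (θ.postComp f).extend (evalCounit hθ N z) =
      evalOne hθ N (contract f.toLin z) := by
  induction z using TensorOver.induction_on with
  | zero => simp only [map_zero]
  | tmul ψ c =>
    rw [evalCounit_tmul, contract_tmul, contract_tmul, SharpDual.extend_one_tmul,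
      evalOne_op_smul]
    rfl
  | add x y hx hy => simp only [map_add, hx, hy]

/-- A rational `φ` is determined by its witness evaluated at `β ∘ ε`, because `β ∘ ε` generates
`_#C` over `*C`. The preimage is `evalCounit` of that witness. -/
theorem exists_evalHom_eq (hC : LocallyProjective A C) (hD : LocallyProjective B D)
    (N : Comod B D) {φ : SharpHom hθ N.AsModule}
    (hφ : (φ : RestrictBase A C (SharpHom hθ N.AsModule)) ∈ rat A C (SharpHom hθ N.AsModule)) :
    ∃ x, evalHom hθ N x = φ := by
  obtain ⟨z, hz⟩ := hφ
  have key : ∀ k : sharpCSub hθ, contract (M := N) k.1.extend (evalCounit hθ N z) = φ.toLin k := by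
    rintro ⟨_, f, rfl⟩
    rw [contract_evalCounit, ← hz]
    -- `(φ f)(β ∘ ε) = φ(f ⇀ (β ∘ ε)) = φ(β ∘ (f ⋆ ε))`, and `ε` is the unit.
    change φ.toLin (toSharp hθ (f * 1)) = _
    rw [mul_one, toSharp]
  refine ⟨⟨evalCounit hθ N z, mem_adCotensor_of_contract hC hD N fun f g => ?_⟩,
    SharpHom.ext key⟩
  -- Compatibility keeps `(β ∘ f) ↼ g` inside `_#C`, so `key` applies to it as well, and the
  -- cotensor criterion becomes the `*D`-linearity of `φ`.
  exact (key (op g • toSharp hθ f)).trans ((φ.toLin.map_smul (op g) _).trans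
    (congrArg (N.actHom g) (key (toSharp hθ f)).symm))

/-! ### The natural isomorphism -/

/-- The component `N □_D (B ⊗_A C) → Rat(Hom(_#C, N))` of the comparison of ad-induction with
coinduction. -/
noncomputable def adToCoind (hC : LocallyProjective A C) (N : Comod B D) :
    (θ.adInduction hC).obj N ⟶ (coind hC hθ).obj N :=
  let w : θ.adComod hC N →ₗ[Aᵐᵒᵖ] ratComod (SharpHom hθ N.AsModule) hC :=
    { toFun := fun x => ⟨evalHom hθ N x, evalHom_mem_rat hθ hC N x⟩
      map_add' := fun x y => Subtype.ext ((evalHom hθ N).map_add x y)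
      map_smul' := fun a x => Subtype.ext
        ((congrArg (evalHom hθ N) (Subtype.ext (ofBase_smul_big N (unop a) x.1))).trans
          ((evalHom hθ N).map_smul (op (LeftDual.ofBase A C (unop a))) x)) }
  ⟨w, colinear_of_act hC _ _ w fun f x =>
    (congrArg w (θ.contract_adCoact hC N f x)).trans
      ((Subtype.ext ((evalHom hθ N).map_smul (op f) x)).trans
        (contract_ratComod hC f (w x)).symm)⟩

theorem adToCoind_bijective (hC : LocallyProjective A C) (hD : LocallyProjective B D)
    (N : Comod B D) : Function.Bijective (Comod.Hom.toLin (adToCoind hθ hC N)) := by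
  refine ⟨fun x y h => evalHom_injective hθ hC N (congrArg Subtype.val h), fun φ => ?_⟩
  obtain ⟨x, hx⟩ := exists_evalHom_eq hθ hC hD N φ.2
  exact ⟨x, Subtype.ext hx⟩

/-- The natural transformation from ad-induction to coinduction. -/
noncomputable def adInductionToCoind (hC : LocallyProjective A C) :
    θ.adInduction hC ⟶ coind hC hθ where
  app := adToCoind hθ hC
  naturality N N' _ := Comod.hom_ext fun x => Subtype.ext (SharpHom.ext fun h =>
    -- Naturality at `h`: contracting the second factor commutes with a map applied to the first.
    contract_map (M := N) (M' := N') _ _ _ _ h.1.extend h.1.extend (fun _ => rfl) x.1)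

end CoringHom

end

end Corings

theorem mainTheorem5 {R : Type v} [CommRing R] {A B C D : Type u} [Ring A] [Algebra R A]
    [Ring B] [Algebra R B] (β : A →ₐ[R] B)
    [AddCommGroup C] [Module A C] [Module Aᵐᵒᵖ C] [SMulCommClass A Aᵐᵒᵖ C] [Corings.Coring A C]
    [AddCommGroup D] [Module B D] [Module Bᵐᵒᵖ D] [SMulCommClass B Bᵐᵒᵖ D] [Corings.Coring B D]
    (θ : Corings.CoringHom (β : A →+* B) C D)
    (hC : Corings.LocallyProjective A C) (hD : Corings.LocallyProjective B D)
    (hθ : θ.Compatible) :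
    Nonempty (Corings.CoringHom.coind hC hθ ≅ θ.adInduction hC) :=
  have := fun N => Corings.Comod.isIso_of_bijective hC _
    (Corings.CoringHom.adToCoind_bijective hθ hC hD N)
  have : ∀ N, CategoryTheory.IsIso ((Corings.CoringHom.adInductionToCoind hθ hC).app N) := this
  have := CategoryTheory.NatIso.isIso_of_isIso_app (Corings.CoringHom.adInductionToCoind hθ hC)
  ⟨(CategoryTheory.asIso (Corings.CoringHom.adInductionToCoind hθ hC)).symm⟩
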